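/- Let $X$ be a metric space with metric $d$ (for example $\mathbb{R}^D$ with any metric), let $x_1,\dots,x_n\in X$ be data points, each carrying one of $l=2$ attribute values, let $s_1,\dots,s_k\in X$ be fixed centers, and let $p\in(0,\infty]$. A clustering is an assignment $\varphi:\{1,\dots,n\}\to\{1,\dots,k\}$. Its clusters are $C_i=\varphi^{-1}(i)$, and $C_i^a$ is the set of points of attribute $a$ in $C_i$. Its cost is $c(\varphi)=\big(\sum_{j=1}^n d(x_j,s_{\varphi(j)})^p\big)^{1/p}$, read as $\max_j d(x_j,s_{\varphi(j)})$ if $p=\infty$, and its unfairness is the max imbalance $f(\varphi)=\max_{i}\big||C_i^1|-|C_i^2|\big|$ (an empty maximum is $0$). A clustering $\psi$ dominates $\varphi$ if $c(\psi)\le c(\varphi)$ and $f(\psi)\le f(\varphi)$ with at least one inequality strict; the Pareto front consists of the undominated clusterings. Then the Pareto front of the assignment problem can be computed in polynomial time: there are a single program and a polynomial $P$ such that for all such data (all $X$, $n$, $k$, points, centers, attributes and $p$) the program, given $n$, $k$, the attributes, the numbers $d(x_j,s_i)^p$ (the numbers $d(x_j,s_i)$ if $p=\infty$) and the bit telling whether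 $p=\infty$, halts after at most $P(n+k)$ elementary operations and outputs a list of undominated clusterings in which every pair $(c(\varphi),f(\varphi))$ attained by an undominated clustering $\varphi$ is attained by exactly one entry. The machine is a random access machine with natural and exact real numbers, whose elementary operations are reading and writing a memory cell, integer constants, addition, subtraction (truncated at $0$ for natural numbers), comparison, logical connectives, and the control steps of while-programs, each at unit cost; there is no unit-cost multiplication and no rounding of reals. -/

import Mathlib

open scoped ENNReal

namespace FairAssign

/-! ## Assignment problem with two attribute values

`n` data points `x j` and `k` fixed centers `s i` in a metric space `X`, and an attribute
`σ j : Fin 2` for every data point. A clustering is a map `φ : Fin n → Fin k`; cluster `i` is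
the set of `j` with `φ j = i`. -/

section Problem

variable {X : Type*} [MetricSpace X] {n k : ℕ}

/-- The metric-based cost `(∑ j, d(x j, s (φ j)) ^ p) ^ (1 / p)`; for `p = ∞` it is
`max j, d(x j, s (φ j))` (which is `0` if there are no data points). -/
noncomputable def cost (p : ℝ≥0∞) (x : Fin n → X) (s : Fin k → X) (φ : Fin n → Fin k) : ℝ :=
  if p = ∞ then ⨆ j, dist (x j) (s (φ j))
  else (∑ j, dist (x j) (s (φ j)) ^ p.toReal) ^ (1 / p.toReal)

/-- The number `|C_i^a|` of data points of attribute `a` in cluster `i`. -/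
def groupCount (σ : Fin n → Fin 2) (φ : Fin n → Fin k) (i : Fin k) (a : Fin 2) : ℕ :=
  (Finset.univ.filter fun j => φ j = i ∧ σ j = a).card

/-- The max imbalance `max i, | |C_i^1| - |C_i^2| |`, the attribute values being `0` and `1`. -/
def maxImbalance (σ : Fin n → Fin 2) (φ : Fin n → Fin k) : ℕ :=
  Finset.univ.sup fun i : Fin k =>
    ((groupCount σ φ i 0 : ℤ) - (groupCount σ φ i 1 : ℤ)).natAbs

/-- `φ` dominates `ψ`: it is at least as good in both objectives and better in one of them. -/
def Dominates (p : ℝ≥0∞) (x : Fin n → X) (s : Fin k → X) (σ : Fin n → Fin 2)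
    (φ ψ : Fin n → Fin k) : Prop :=
  cost p x s φ ≤ cost p x s ψ ∧ maxImbalance σ φ ≤ maxImbalance σ ψ ∧
    (cost p x s φ < cost p x s ψ ∨ maxImbalance σ φ < maxImbalance σ ψ)

/-- `φ` is undominated. -/
def Undominated (p : ℝ≥0∞) (x : Fin n → X) (s : Fin k → X) (σ : Fin n → Fin 2)
    (φ : Fin n → Fin k) : Prop :=
  ∀ ψ : Fin n → Fin k, ¬ Dominates p x s σ ψ φ

/-- `L` lists the Pareto front: it consists of undominated clusterings, and every pair of
objective values that an undominated clustering attains is attained by exactly one entry. -/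
def ListsParetoFront (p : ℝ≥0∞) (x : Fin n → X) (s : Fin k → X) (σ : Fin n → Fin 2)
    (L : List (Fin n → Fin k)) : Prop :=
  (∀ φ ∈ L, Undominated p x s σ φ) ∧
  (∀ φ, Undominated p x s σ φ →
    ∃ ψ ∈ L, cost p x s ψ = cost p x s φ ∧ maxImbalance σ ψ = maxImbalance σ φ) ∧
  L.Pairwise fun φ ψ => ¬ (cost p x s φ = cost p x s ψ ∧ maxImbalance σ φ = maxImbalance σ ψ)

end Problem

/-! ## A random access machine over the naturals and the reals

Programs are while-programs over named two-dimensional arrays of natural numbers and of real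
numbers. The arithmetic on both sorts is addition and subtraction with integer constants, and
real numbers influence the control flow and the natural numbers only through comparisons. There
is no unit-cost multiplication, rounding, or arbitrary real constant. -/

/-- The memory: cell `(i, j)` of the array with name `a` is `nat a i j`, resp. `real a i j`. -/
structure State where
  nat : ℕ → ℕ → ℕ → ℕ
  real : ℕ → ℕ → ℕ → ℝ

/-- Expressions with natural values. -/
inductive NExp
  | const (c : ℕ)
  | read (a : ℕ) (i j : NExp)
  | add (e₁ e₂ : NExp)
  | sub (e₁ e₂ : NExp)

/-- Expressions with real values. -/
inductive RExp
  | const (c : ℤ)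
  | read (a : ℕ) (i j : NExp)
  | add (e₁ e₂ : RExp)
  | sub (e₁ e₂ : RExp)

/-- Tests. -/
inductive BExp
  | natLe (e₁ e₂ : NExp)
  | realLe (e₁ e₂ : RExp)
  | not (b : BExp)
  | and (b₁ b₂ : BExp)

/-- The value of an expression; subtraction of naturals is truncated at `0`. -/
def NExp.eval (m : State) : NExp → ℕ
  | .const c => c
  | .read a i j => m.nat a (i.eval m) (j.eval m)
  | .add e₁ e₂ => e₁.eval m + e₂.eval m
  | .sub e₁ e₂ => e₁.eval m - e₂.eval m

def RExp.eval (m : State) : RExp → ℝ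
  | .const c => (c : ℝ)
  | .read a i j => m.real a (i.eval m) (j.eval m)
  | .add e₁ e₂ => e₁.eval m + e₂.eval m
  | .sub e₁ e₂ => e₁.eval m - e₂.eval m

def BExp.holds (m : State) : BExp → Prop
  | .natLe e₁ e₂ => e₁.eval m ≤ e₂.eval m
  | .realLe e₁ e₂ => e₁.eval m ≤ e₂.eval m
  | .not b => ¬ b.holds m
  | .and b₁ b₂ => b₁.holds m ∧ b₂.holds m

/-- The number of elementary operations spent on an expression. -/
def NExp.time : NExp → ℕ
  | .const _ => 1
  | .read _ i j => i.time + j.time + 1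
  | .add e₁ e₂ => e₁.time + e₂.time + 1
  | .sub e₁ e₂ => e₁.time + e₂.time + 1

def RExp.time : RExp → ℕ
  | .const _ => 1
  | .read _ i j => i.time + j.time + 1
  | .add e₁ e₂ => e₁.time + e₂.time + 1
  | .sub e₁ e₂ => e₁.time + e₂.time + 1

def BExp.time : BExp → ℕ
  | .natLe e₁ e₂ => e₁.time + e₂.time + 1
  | .realLe e₁ e₂ => e₁.time + e₂.time + 1
  | .not b => b.time + 1
  | .and b₁ b₂ => b₁.time + b₂.time + 1

/-- Programs. -/
inductive Cmd
  | skip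
  | setNat (a : ℕ) (i j e : NExp)
  | setReal (a : ℕ) (i j : NExp) (e : RExp)
  | seq (c₁ c₂ : Cmd)
  | ite (b : BExp) (c₁ c₂ : Cmd)
  | loop (b : BExp) (c : Cmd)

/-- Write `v` into cell `(i, j)` of the natural array `a`. -/
def State.putNat (m : State) (a i j v : ℕ) : State :=
  { m with nat := fun a' i' j' => if a' = a ∧ i' = i ∧ j' = j then v else m.nat a' i' j' }

/-- Write `v` into cell `(i, j)` of the real array `a`. -/
noncomputable def State.putReal (m : State) (a i j : ℕ) (v : ℝ) : State :=
  { m with real := fun a' i' j' => if a' = a ∧ i' = i ∧ j' = j then v else m.real a' i' j' }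

/-- `Exec c m t m'`: program `c`, started in memory `m`, halts after `t` elementary operations
with memory `m'`. -/
inductive Exec : Cmd → State → ℕ → State → Prop
  | skip (m : State) : Exec .skip m 1 m
  | setNat (a : ℕ) (i j e : NExp) (m : State) :
      Exec (.setNat a i j e) m (i.time + j.time + e.time + 1)
        (m.putNat a (i.eval m) (j.eval m) (e.eval m))
  | setReal (a : ℕ) (i j : NExp) (e : RExp) (m : State) :
      Exec (.setReal a i j e) m (i.time + j.time + e.time + 1)
        (m.putReal a (i.eval m) (j.eval m) (e.eval m))
  | seq {c₁ c₂ : Cmd} {m m' m'' : State} {t₁ t₂ : ℕ}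
      (h₁ : Exec c₁ m t₁ m') (h₂ : Exec c₂ m' t₂ m'') :
      Exec (.seq c₁ c₂) m (t₁ + t₂) m''
  | iteTrue {b : BExp} {c₁ c₂ : Cmd} {m m' : State} {t : ℕ}
      (hb : b.holds m) (h : Exec c₁ m t m') :
      Exec (.ite b c₁ c₂) m (b.time + t + 1) m'
  | iteFalse {b : BExp} {c₁ c₂ : Cmd} {m m' : State} {t : ℕ}
      (hb : ¬ b.holds m) (h : Exec c₂ m t m') :
      Exec (.ite b c₁ c₂) m (b.time + t + 1) m'
  | loopTrue {b : BExp} {c : Cmd} {m m' m'' : State} {t₁ t₂ : ℕ}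
      (hb : b.holds m) (h₁ : Exec c m t₁ m') (h₂ : Exec (.loop b c) m' t₂ m'') :
      Exec (.loop b c) m (b.time + t₁ + t₂ + 1) m''
  | loopFalse {b : BExp} {c : Cmd} {m : State} (hb : ¬ b.holds m) :
      Exec (.loop b c) m (b.time + 1) m

/-- The machine is deterministic. -/
theorem Exec.det {c : Cmd} {m m₁ m₂ : State} {t₁ t₂ : ℕ}
    (h₁ : Exec c m t₁ m₁) (h₂ : Exec c m t₂ m₂) : t₁ = t₂ ∧ m₁ = m₂ := by
  induction h₁ generalizing t₂ m₂ with
  | skip => cases h₂; exact ⟨rfl, rfl⟩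
  | setNat => cases h₂; exact ⟨rfl, rfl⟩
  | setReal => cases h₂; exact ⟨rfl, rfl⟩
  | seq _ _ ih₁ ih₂ =>
    cases h₂ with
    | seq g₁ g₂ =>
      obtain ⟨rfl, rfl⟩ := ih₁ g₁
      obtain ⟨rfl, rfl⟩ := ih₂ g₂
      exact ⟨rfl, rfl⟩
  | iteTrue hb _ ih =>
    cases h₂ with
    | iteTrue _ g => obtain ⟨rfl, rfl⟩ := ih g; exact ⟨rfl, rfl⟩
    | iteFalse hb' _ => exact absurd hb hb'
  | iteFalse hb _ ih =>
    cases h₂ with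
    | iteTrue hb' _ => exact absurd hb' hb
    | iteFalse _ g => obtain ⟨rfl, rfl⟩ := ih g; exact ⟨rfl, rfl⟩
  | loopTrue hb _ _ ih₁ ih₂ =>
    cases h₂ with
    | loopTrue _ g₁ g₂ =>
      obtain ⟨rfl, rfl⟩ := ih₁ g₁
      obtain ⟨rfl, rfl⟩ := ih₂ g₂
      exact ⟨rfl, rfl⟩
    | loopFalse hb' => exact absurd hb hb'
  | loopFalse hb =>
    cases h₂ with
    | loopTrue hb' _ _ => exact absurd hb' hb
    | loopFalse _ => exact ⟨rfl, rfl⟩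

/-! ## Input and output -/

section InputOutput

variable {X : Type*} [MetricSpace X] {n k : ℕ}

/-- The contribution `d(x j, s i) ^ p` of a point to the cost if it is assigned to center `i`;
for `p = ∞` it is `d(x j, s i)`. -/
noncomputable def contribution (p : ℝ≥0∞) (x : Fin n → X) (s : Fin k → X)
    (j : Fin n) (i : Fin k) : ℝ :=
  if p = ∞ then dist (x j) (s i) else dist (x j) (s i) ^ p.toReal

open Classical in
/-- The memory that holds an instance. Natural array `0`: `n`, `k` and the bit telling whether
`p = ∞`, in the cells `(0, 0)`, `(1, 0)` and `(2, 0)`. Natural array `1`: the attribute of point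
`j` in cell `(j, 0)`. Real array `0`: the contribution of point `j` and center `i` in cell
`(j, i)`. Everything else is zero. -/
noncomputable def inputState (p : ℝ≥0∞) (x : Fin n → X) (s : Fin k → X) (σ : Fin n → Fin 2) :
    State where
  nat a i j :=
    if a = 0 ∧ i = 0 ∧ j = 0 then n
    else if a = 0 ∧ i = 1 ∧ j = 0 then k
    else if a = 0 ∧ i = 2 ∧ j = 0 then (if p = ∞ then 1 else 0)
    else if h : a = 1 ∧ i < n ∧ j = 0 then (σ ⟨i, h.2.1⟩ : ℕ)
    else 0
  real a j i :=
    if h : a = 0 ∧ j < n ∧ i < k then contribution p x s ⟨j, h.2.1⟩ ⟨i, h.2.2⟩ else 0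

/-- The list of clusterings written in a memory. Natural array `2`: the length of the list in
cell `(0, 0)`. Natural array `3`: the cluster of point `j` in entry `r` in cell `(r, j)`. -/
def Outputs (m : State) (L : List (Fin n → Fin k)) : Prop :=
  m.nat 2 0 0 = L.length ∧
    ∀ (r : Fin L.length) (j : Fin n), m.nat 3 r j = (L.get r j : ℕ)

end InputOutput

end FairAssign

/-!
For every bound `f = 0, …, n` on the max imbalance, the program computes a clustering of least cost
among those that obey the bound, and lists it if its cost is smaller than that of all clusterings
listed before. Nothing of smaller imbalance is then as cheap, so exactly the Pareto front is
listed, each pair of values once (`FrontBelow.append`, `FrontBelow.skip`).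

*Fixed bound.* The bound is replaced by the convex penalty `M * max (|b| - f) 0` on the imbalance
`b` of each cluster, with `M` above the total weight, so that a minimizer obeys the bound if any
clustering does (`Certificate.balanced`). Minimizing weight plus penalty is a minimum cost flow
problem with convex costs, in which a point of one attribute sends a unit to its center and a point
of the other attribute takes one from it. It is solved by successive shortest paths: the points are
inserted one at a time, and each time the assignment is augmented along a shortest path in the
exchange graph, whose vertices are the centers and whose arcs move one point (`Arc`). Optimality is
certified by prices of the centers (`Certificate`): weak duality is `Certificate.optimal`. The
prices make the reduced arc weights nonnegative, so that Dijkstra's algorithm finds the shortest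
paths (`Dijkstra`), and they are updated from the distances so that all moved points sit at
cheapest centers again (`Augmenting.step`, `Augmenting.finish`). There are `n` augmentations for
every bound, whatever the weights, so the number of operations is polynomial in `n + k`.

*The case `p = ∞`.* The maximum is minimized as a sum: the contributions are replaced by powers of
`2` in the same order, so far apart that `n` smaller weights never make up for a larger one
(`objective_mono`). Their exponents are at most `n * (n * k)`, so polynomially many additions
produce them.

*Running time.* All loops of the program are `for` loops with at most `n + k + 1` iterations, so a
polynomial time bound can be read off from the syntax (`Cmd.bound`). A weakest precondition
calculus (`Wp`) proves termination, correctness and the time bound together.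
-/

namespace FairAssign

/-! ### Reasoning about programs -/

section Programs

/-- A polynomial bound on the running time of a program all of whose loops make at most `N + 1`
iterations, as a polynomial in `N`. -/
noncomputable def Cmd.bound : Cmd → Polynomial ℕ
  | .skip => 1
  | .setNat _ i j e => Polynomial.C (i.time + j.time + e.time + 1)
  | .setReal _ i j e => Polynomial.C (i.time + j.time + e.time + 1)
  | .seq c₁ c₂ => c₁.bound + c₂.bound
  | .ite b c₁ c₂ => Polynomial.C (b.time + 1) + c₁.bound + c₂.bound
  | .loop b c => (Polynomial.X + 2) * (Polynomial.C (b.time + 1) + c.bound)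

/-- Whether a program contains an assignment to the natural array `a`. -/
def Cmd.writesNat (a : ℕ) : Cmd → Bool
  | .skip => false
  | .setNat a' _ _ _ => a == a'
  | .setReal _ _ _ _ => false
  | .seq c₁ c₂ => c₁.writesNat a || c₂.writesNat a
  | .ite _ c₁ c₂ => c₁.writesNat a || c₂.writesNat a
  | .loop _ c => c.writesNat a

/-- Whether a program contains an assignment to the real array `a`. -/
def Cmd.writesReal (a : ℕ) : Cmd → Bool
  | .skip => false
  | .setNat _ _ _ _ => false
  | .setReal a' _ _ _ => a == a'
  | .seq c₁ c₂ => c₁.writesReal a || c₂.writesReal a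
  | .ite _ c₁ c₂ => c₁.writesReal a || c₂.writesReal a
  | .loop _ c => c.writesReal a

/-- The memories `m` and `m'` agree on all arrays that `c` does not write. -/
def Frame (c : Cmd) (m m' : State) : Prop :=
  (∀ a, c.writesNat a = false → m'.nat a = m.nat a) ∧
    ∀ a, c.writesReal a = false → m'.real a = m.real a

theorem Frame.refl (c : Cmd) (m : State) : Frame c m m := ⟨fun _ _ => rfl, fun _ _ => rfl⟩

theorem Frame.trans {c : Cmd} {m m' m'' : State} (h : Frame c m m') (h' : Frame c m' m'') :
    Frame c m m'' :=
  ⟨fun a ha => (h'.1 a ha).trans (h.1 a ha), fun a ha => (h'.2 a ha).trans (h.2 a ha)⟩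

theorem Frame.mono {c c' : Cmd} {m m' : State} (h : Frame c m m')
    (hn : ∀ a, c'.writesNat a = false → c.writesNat a = false)
    (hr : ∀ a, c'.writesReal a = false → c.writesReal a = false) : Frame c' m m' :=
  ⟨fun a ha => h.1 a (hn a ha), fun a ha => h.2 a (hr a ha)⟩

@[simp] theorem State.putNat_real (m : State) (a i j v : ℕ) : (m.putNat a i j v).real = m.real :=
  rfl

@[simp] theorem State.putReal_nat (m : State) (a i j : ℕ) (v : ℝ) :
    (m.putReal a i j v).nat = m.nat := rfl

theorem State.putNat_nat_ne (m : State) {a a' : ℕ} (i j v : ℕ) (h : a' ≠ a) :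
    (m.putNat a i j v).nat a' = m.nat a' := by
  funext i' j'; simp [State.putNat, h]

theorem State.putReal_real_ne (m : State) {a a' : ℕ} (i j : ℕ) (v : ℝ) (h : a' ≠ a) :
    (m.putReal a i j v).real a' = m.real a' := by
  funext i' j'; simp [State.putReal, h]

theorem State.putNat_row_ne (m : State) (a : ℕ) {i i' : ℕ} (j v : ℕ) (h : i' ≠ i) :
    (m.putNat a i j v).nat a i' = m.nat a i' := by
  funext j'; simp [State.putNat, h]

theorem State.putReal_row_ne (m : State) (a : ℕ) {i i' : ℕ} (j : ℕ) (v : ℝ) (h : i' ≠ i) :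
    (m.putReal a i j v).real a i' = m.real a i' := by
  funext j'; simp [State.putReal, h]

@[simp] theorem State.putNat_row (m : State) (a i j v : ℕ) :
    (m.putNat a i j v).nat a i = Function.update (m.nat a i) j v := by
  funext j'; simp [State.putNat, Function.update_apply]

@[simp] theorem State.putReal_row (m : State) (a i j : ℕ) (v : ℝ) :
    (m.putReal a i j v).real a i = Function.update (m.real a i) j v := by
  funext j'; simp [State.putReal, Function.update_apply]

theorem Exec.frame {c : Cmd} {m m' : State} {t : ℕ} (h : Exec c m t m') : Frame c m m' := by
  induction h with
  | skip => exact Frame.refl _ _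
  | setNat a i j e m =>
    refine ⟨fun b hb => State.putNat_nat_ne _ _ _ _ ?_, fun _ _ => rfl⟩
    simpa [Cmd.writesNat] using hb
  | setReal a i j e m =>
    refine ⟨fun _ _ => rfl, fun b hb => State.putReal_real_ne _ _ _ _ ?_⟩
    simpa [Cmd.writesReal] using hb
  | seq _ _ ih₁ ih₂ =>
    exact (ih₁.mono (by simp +contextual [Cmd.writesNat])
      (by simp +contextual [Cmd.writesReal])).trans
      (ih₂.mono (by simp +contextual [Cmd.writesNat]) (by simp +contextual [Cmd.writesReal]))
  | iteTrue _ _ ih =>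
    exact ih.mono (by simp +contextual [Cmd.writesNat]) (by simp +contextual [Cmd.writesReal])
  | iteFalse _ _ ih =>
    exact ih.mono (by simp +contextual [Cmd.writesNat]) (by simp +contextual [Cmd.writesReal])
  | loopTrue _ _ _ ih₁ ih₂ =>
    exact (ih₁.mono (by simp [Cmd.writesNat]) (by simp [Cmd.writesReal])).trans ih₂
  | loopFalse => exact Frame.refl _ _

/-- Weakest precondition with time bound: `c`, started in `m`, halts within `c.bound` evaluated
at `N`, in a memory that satisfies `Q`. -/
def Wp (N : ℕ) (c : Cmd) (Q : State → Prop) (m : State) : Prop :=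
  ∃ t m', Exec c m t m' ∧ t ≤ c.bound.eval N ∧ Q m'

variable {N : ℕ} {Q R : State → Prop} {m : State}

theorem Wp.mono {c : Cmd} (h : Wp N c Q m) (hQ : ∀ m', Frame c m m' → Q m' → R m') :
    Wp N c R m := by
  obtain ⟨t, m', h, ht, hq⟩ := h
  exact ⟨t, m', h, ht, hQ _ h.frame hq⟩

theorem wp_skip (h : Q m) : Wp N .skip Q m := ⟨1, m, .skip m, by simp [Cmd.bound], h⟩

theorem wp_setNat {a : ℕ} {i j e : NExp} (h : Q (m.putNat a (i.eval m) (j.eval m) (e.eval m))) :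
    Wp N (.setNat a i j e) Q m :=
  ⟨_, _, .setNat a i j e m, by simp [Cmd.bound], h⟩

theorem wp_setReal {a : ℕ} {i j : NExp} {e : RExp}
    (h : Q (m.putReal a (i.eval m) (j.eval m) (e.eval m))) :
    Wp N (.setReal a i j e) Q m :=
  ⟨_, _, .setReal a i j e m, by simp [Cmd.bound], h⟩

theorem wp_seq {c₁ c₂ : Cmd} (h : Wp N c₁ (Wp N c₂ Q) m) : Wp N (.seq c₁ c₂) Q m := by
  obtain ⟨t₁, m₁, h₁, ht₁, t₂, m₂, h₂, ht₂, hQ⟩ := h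
  refine ⟨_, _, .seq h₁ h₂, ?_, hQ⟩
  simp only [Cmd.bound, Polynomial.eval_add]
  omega

theorem wp_ite {b : BExp} {c₁ c₂ : Cmd} (h₁ : b.holds m → Wp N c₁ Q m)
    (h₂ : ¬ b.holds m → Wp N c₂ Q m) : Wp N (.ite b c₁ c₂) Q m := by
  by_cases hb : b.holds m
  · obtain ⟨t, m', h, ht, hQ⟩ := h₁ hb
    refine ⟨_, _, .iteTrue hb h, ?_, hQ⟩
    simp only [Cmd.bound, Polynomial.eval_add, Polynomial.eval_C]
    omega
  · obtain ⟨t, m', h, ht, hQ⟩ := h₂ hb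
    refine ⟨_, _, .iteFalse hb h, ?_, hQ⟩
    simp only [Cmd.bound, Polynomial.eval_add, Polynomial.eval_C]
    omega

theorem wp_loop {b : BExp} {c : Cmd} {B : ℕ} (hB : B ≤ N + 1) (I : ℕ → State → Prop)
    (h0 : I 0 m)
    (hstep : ∀ i m', i < B → I i m' → b.holds m' ∧ Wp N c (I (i + 1)) m')
    (hend : ∀ m', I B m' → ¬ b.holds m' ∧ Q m') : Wp N (.loop b c) Q m := by
  -- `d` iterations remain
  have key : ∀ d i m', i + d = B → I i m' → ∃ t m'', Exec (.loop b c) m' t m'' ∧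
      t ≤ (d + 1) * (b.time + 1 + c.bound.eval N) ∧ Q m'' := by
    intro d
    induction d with
    | zero =>
      intro i m' hi hI
      obtain rfl : i = B := by omega
      obtain ⟨hb, hQ⟩ := hend m' hI
      exact ⟨_, _, .loopFalse hb, by linarith [Nat.zero_le (c.bound.eval N)], hQ⟩
    | succ d ih =>
      intro i m' hi hI
      obtain ⟨hb, t₁, m₁, h₁, ht₁, hI₁⟩ := hstep i m' (by omega) hI
      obtain ⟨t₂, m₂, h₂, ht₂, hQ⟩ := ih (i + 1) m₁ (by omega) hI₁
      refine ⟨_, _, .loopTrue hb h₁ h₂, ?_, hQ⟩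
      linarith
  obtain ⟨t, m', h, ht, hQ⟩ := key B 0 m (by omega) h0
  refine ⟨t, m', h, ht.trans ?_, hQ⟩
  simp only [Cmd.bound, Polynomial.eval_mul, Polynomial.eval_add, Polynomial.eval_X,
    Polynomial.eval_C, Polynomial.eval_ofNat]
  exact Nat.mul_le_mul_right _ (by omega)

/-- The scalar variable kept in the cell `(0, 0)` of the natural array `a`. -/
abbrev var (a : ℕ) : NExp := .read a (.const 0) (.const 0)

/-- The assignment to the scalar variable kept in the cell `(0, 0)` of the natural array `a`. -/
abbrev setVar (a : ℕ) (e : NExp) : Cmd := .setNat a (.const 0) (.const 0) e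

/-- The loop in which the scalar variable `a` runs from `0` to `e - 1`. -/
def forLoop (a : ℕ) (e : NExp) (c : Cmd) : Cmd :=
  .seq (setVar a (.const 0))
    (.loop (.natLe (.add (var a) (.const 1)) e) (.seq c (setVar a (.add (var a) (.const 1)))))

/-- The rule for `for` loops with an invariant `I`. As the loop leaves the arrays alone that it does
not write (`Frame`), `I` need only speak of those that it writes. -/
theorem wp_forLoop {a B : ℕ} {e : NExp} {c : Cmd} (I : ℕ → State → Prop) (hB : B ≤ N + 1)
    (ha : c.writesNat a = false)
    (he : ∀ m', Frame (forLoop a e c) m m' → e.eval m' = B)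
    (h0 : I 0 (m.putNat a 0 0 0))
    (hstep : ∀ i m', i < B → Frame (forLoop a e c) m m' → m'.nat a 0 0 = i → I i m' →
      Wp N c (fun m'' => I (i + 1) (m''.putNat a 0 0 (i + 1))) m')
    (hend : ∀ m', Frame (forLoop a e c) m m' → I B m' → Q m') :
    Wp N (forLoop a e c) Q m := by
  have hw : (forLoop a e c).writesNat a = true := by simp [forLoop, Cmd.writesNat]
  have hput : ∀ m' v, Frame (forLoop a e c) m' (m'.putNat a 0 0 v) := fun m' v =>
    ⟨fun b hb => State.putNat_nat_ne _ _ _ _ (by rintro rfl; simp [hw] at hb), fun _ _ => rfl⟩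
  have hc : ∀ m' m'', Frame c m' m'' → Frame (forLoop a e c) m' m'' := fun m' m'' h =>
    h.mono (by simp +contextual [forLoop, Cmd.writesNat])
      (by simp +contextual [forLoop, Cmd.writesReal])
  refine wp_seq (wp_setNat ?_)
  refine wp_loop hB (fun i m' => Frame (forLoop a e c) m m' ∧ m'.nat a 0 0 = i ∧ I i m') ?_ ?_ ?_
  · exact ⟨hput _ _, by simp [NExp.eval], h0⟩
  · rintro i m' hi ⟨hF, hv, hI⟩
    refine ⟨?_, wp_seq ?_⟩
    · simp only [BExp.holds, NExp.eval, hv, he _ hF]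
      omega
    · refine (hstep i m' hi hF hv hI).mono fun m'' hF' hI' => wp_setNat ?_
      have hv' : m''.nat a 0 0 = i := by rw [hF'.1 a ha, hv]
      simp only [NExp.eval, hv']
      exact ⟨(hF.trans (hc _ _ hF')).trans (hput _ _), by simp, hI'⟩
  · rintro m' ⟨hF, hv, hI⟩
    refine ⟨?_, hend _ hF hI⟩
    simp only [BExp.holds, NExp.eval, hv, he _ hF]
    omega

end Programs

/-! ### The penalty for imbalance -/

/-- The convex penalty that replaces the constraint `|b| ≤ f`. -/
noncomputable def penalty (f : ℕ) (M : ℝ) (b : ℤ) : ℝ := M * max (|(b : ℝ)| - f) 0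

/-- The slope of the penalty between `b` and `b + 1`. -/
noncomputable def slope (f : ℕ) (M : ℝ) (b : ℤ) : ℝ :=
  if (f : ℤ) ≤ b then M else if b + f < 0 then -M else 0

theorem penalty_succ (f : ℕ) (M : ℝ) (b : ℤ) :
    penalty f M (b + 1) = penalty f M b + slope f M b := by
  unfold penalty slope
  have hf : (0 : ℝ) ≤ f := Nat.cast_nonneg f
  split_ifs with h1 h2
  · have h : (f : ℝ) ≤ b := by exact_mod_cast h1
    rw [abs_of_nonneg (by push_cast; linarith), abs_of_nonneg (by linarith),
      max_eq_left (by push_cast; linarith), max_eq_left (by linarith)]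
    push_cast; ring
  · have h2' : b + 1 + f ≤ 0 := by omega
    have h : (b : ℝ) + 1 + f ≤ 0 := by exact_mod_cast h2'
    rw [abs_of_nonpos (by push_cast; linarith), abs_of_nonpos (by linarith),
      max_eq_left (by push_cast; linarith), max_eq_left (by linarith)]
    push_cast; ring
  · have h1' : b + 1 ≤ f := by omega
    have h : (b : ℝ) + 1 ≤ f := by exact_mod_cast h1'
    have h2' : 0 ≤ b + f := by omega
    have h' : 0 ≤ (b : ℝ) + f := by exact_mod_cast h2'
    have e1 : |(b : ℝ)| ≤ f := abs_le.2 ⟨by linarith, by linarith⟩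
    have e2 : |((b + 1 : ℤ) : ℝ)| ≤ f := abs_le.2 ⟨by push_cast; linarith, by push_cast; linarith⟩
    rw [max_eq_right (by linarith), max_eq_right (by linarith)]
    ring

theorem slope_mono {f : ℕ} {M : ℝ} (hM : 0 ≤ M) : Monotone (slope f M) := by
  intro b b' h
  unfold slope
  split_ifs <;> first | omega | linarith

theorem slope_neg (f : ℕ) (M : ℝ) (b : ℤ) : slope f M (-b - 1) = -slope f M b := by
  unfold slope
  have hM : M = 0 ∨ M ≠ 0 := em _
  split_ifs <;> first | omega | simp

theorem slope_neg_one_le {f : ℕ} {M : ℝ} (hM : 0 ≤ M) : slope f M (0 - 1) ≤ 0 := by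
  unfold slope
  split_ifs <;> first | omega | linarith

theorem slope_zero_nonneg {f : ℕ} {M : ℝ} (hM : 0 ≤ M) : 0 ≤ slope f M 0 := by
  unfold slope
  split_ifs <;> first | omega | linarith

/-- A number between the slopes on both sides of `b` is a subgradient at `b`. -/
theorem penalty_subgradient {f : ℕ} {M : ℝ} (hM : 0 ≤ M) {b : ℤ} {r : ℝ}
    (h₁ : slope f M (b - 1) ≤ r) (h₂ : r ≤ slope f M b) (b' : ℤ) :
    penalty f M b + r * ((b' : ℝ) - b) ≤ penalty f M b' := by
  have up : ∀ d : ℕ, penalty f M b + r * d ≤ penalty f M (b + d) := by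
    intro d
    induction d with
    | zero => simp
    | succ d ih =>
      have := penalty_succ f M (b + d)
      have h := slope_mono (f := f) hM (show b ≤ b + d by omega)
      push_cast
      rw [← add_assoc, this]
      linarith
  have down : ∀ d : ℕ, penalty f M b - r * d ≤ penalty f M (b - d) := by
    intro d
    induction d with
    | zero => simp
    | succ d ih =>
      have := penalty_succ f M (b - (d + 1))
      rw [show b - ((d : ℤ) + 1) + 1 = b - d by ring] at this
      have h := slope_mono (f := f) hM (show b - ((d : ℤ) + 1) ≤ b - 1 by omega)
      push_cast
      linarith
  rcases le_total b b' with h | h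
  · obtain ⟨d, rfl⟩ := Int.le.dest h
    have := up d
    push_cast
    linarith
  · obtain ⟨d, hd⟩ := Int.le.dest h
    obtain rfl : b' = b - d := by omega
    have := down d
    push_cast
    linarith

theorem penalty_nonneg {M : ℝ} (hM : 0 ≤ M) (f : ℕ) (b : ℤ) : 0 ≤ penalty f M b :=
  mul_nonneg hM (le_max_right _ _)

theorem penalty_eq_zero {f : ℕ} {b : ℤ} (M : ℝ) (h : |b| ≤ f) : penalty f M b = 0 := by
  have h' : |(b : ℝ)| ≤ f := by exact_mod_cast h
  rw [penalty, max_eq_right (by linarith), mul_zero]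

theorem le_penalty {f : ℕ} {M : ℝ} {b : ℤ} (hM : 0 ≤ M) (h : ¬ |b| ≤ f) : M ≤ penalty f M b := by
  have h1 : (f : ℤ) + 1 ≤ |b| := by omega
  have h' : (f : ℝ) + 1 ≤ |(b : ℝ)| := by exact_mod_cast h1
  refine le_mul_of_one_le_right hM (le_max_of_le_left (by linarith))

/-! ### Optimality certificates

Assignments, attributes and weights are functions on all of `ℕ`, of which only the values at
`q < j` (points) and `v < k` (centers) matter. Everything is relative to an attribute `a`. -/

/-- The contribution of point `q` to the imbalance of its cluster: `1` if it has attribute `a`,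
`-1` otherwise. -/
def sgn (a : ℕ) (σ : ℕ → ℕ) (q : ℕ) : ℤ := if σ q = a then 1 else -1

/-- The imbalance of cluster `v`, counting the points `q < j` only: those of attribute `a` minus
the others. -/
def bal (a : ℕ) (σ φ : ℕ → ℕ) (j v : ℕ) : ℤ :=
  ∑ q ∈ Finset.range j, if φ q = v then sgn a σ q else 0

/-- The prices `ρ` certify that every one of the first `j` points sits at a center that is cheapest
for it. A point of attribute `a` pays the price of its center, any other point receives it. -/
def Cheapest (a k j : ℕ) (σ : ℕ → ℕ) (W : ℕ → ℕ → ℝ) (φ : ℕ → ℕ) (ρ : ℕ → ℝ) : Prop :=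
  ∀ q < j, φ q < k ∧ ∀ i < k, W q (φ q) + sgn a σ q * ρ (φ q) ≤ W q i + sgn a σ q * ρ i

/-- The prices `ρ` certify that the first `j` points are assigned optimally: every point sits at a
center that is cheapest for it, and the price of a center is a subgradient of the penalty at the
imbalance of its cluster. -/
structure Certificate (a k j : ℕ) (σ : ℕ → ℕ) (W : ℕ → ℕ → ℝ) (f : ℕ) (M : ℝ) (φ : ℕ → ℕ)
    (ρ : ℕ → ℝ) : Prop where
  cheapest : Cheapest a k j σ W φ ρ
  slope_le : ∀ v < k, slope f M (bal a σ φ j v - 1) ≤ ρ v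
  le_slope : ∀ v < k, ρ v ≤ slope f M (bal a σ φ j v)

theorem sgn_swap {σ : ℕ → ℕ} {q a : ℕ} (hσ : σ q < 2) (ha : a < 2) :
    sgn (1 - a) σ q = -sgn a σ q := by
  unfold sgn
  split_ifs <;> omega

theorem bal_swap {σ : ℕ → ℕ} {a j : ℕ} (hσ : ∀ q < j, σ q < 2) (ha : a < 2) (φ : ℕ → ℕ) (v : ℕ) :
    bal (1 - a) σ φ j v = -bal a σ φ j v := by
  unfold bal
  rw [← Finset.sum_neg_distrib]
  refine Finset.sum_congr rfl fun q hq => ?_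
  rw [sgn_swap (hσ q (Finset.mem_range.1 hq)) ha]
  split_ifs <;> simp

/-- Counting relative to the other attribute changes the sign of imbalances and prices. -/
theorem Certificate.swap {a k j : ℕ} {σ φ : ℕ → ℕ} {W : ℕ → ℕ → ℝ} {f : ℕ} {M : ℝ} {ρ ρ' : ℕ → ℝ}
    (h : Certificate a k j σ W f M φ ρ) (hσ : ∀ q < j, σ q < 2) (ha : a < 2)
    (hρ : ∀ v < k, ρ' v = -ρ v) : Certificate (1 - a) k j σ W f M φ ρ' := by
  refine ⟨fun q hq => ?_, fun v hv => ?_, fun v hv => ?_⟩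
  · obtain ⟨h1, h2⟩ := h.cheapest q hq
    refine ⟨h1, fun i hi => ?_⟩
    rw [sgn_swap (hσ q hq) ha, hρ _ hi, hρ _ h1]
    simpa using h2 i hi
  · rw [bal_swap hσ ha, hρ v hv, slope_neg]
    exact neg_le_neg (h.le_slope v hv)
  · have := slope_neg f M (bal a σ φ j v - 1)
    rw [bal_swap hσ ha, hρ v hv, show -bal a σ φ j v = -(bal a σ φ j v - 1) - 1 by ring, this]
    exact neg_le_neg (h.slope_le v hv)

/-- The total price of the imbalances, counted by clusters and by points. -/
theorem sum_price {a k j : ℕ} {σ φ : ℕ → ℕ} (hφ : ∀ q < j, φ q < k) (ρ : ℕ → ℝ) :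
    ∑ v ∈ Finset.range k, ρ v * (bal a σ φ j v : ℝ) =
      ∑ q ∈ Finset.range j, (sgn a σ q : ℝ) * ρ (φ q) := by
  simp only [bal, Int.cast_sum, Finset.mul_sum]
  rw [Finset.sum_comm]
  refine Finset.sum_congr rfl fun q hq => ?_
  rw [Finset.sum_eq_single (φ q)]
  · simp [mul_comm]
  · intro v _ hv
    simp [Ne.symm hv]
  · intro h
    exact absurd (Finset.mem_range.2 (hφ q (Finset.mem_range.1 hq))) h

/-- Weak duality. -/
theorem Certificate.optimal {a k j : ℕ} {σ φ : ℕ → ℕ} {W : ℕ → ℕ → ℝ} {f : ℕ} {M : ℝ} {ρ : ℕ → ℝ}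
    (h : Certificate a k j σ W f M φ ρ) (hM : 0 ≤ M) {ψ : ℕ → ℕ} (hψ : ∀ q < j, ψ q < k) :
    ∑ q ∈ Finset.range j, W q (φ q) + ∑ v ∈ Finset.range k, penalty f M (bal a σ φ j v) ≤
      ∑ q ∈ Finset.range j, W q (ψ q) + ∑ v ∈ Finset.range k, penalty f M (bal a σ ψ j v) := by
  have h1 : ∑ q ∈ Finset.range j, (W q (φ q) + sgn a σ q * ρ (φ q)) ≤
      ∑ q ∈ Finset.range j, (W q (ψ q) + sgn a σ q * ρ (ψ q)) :=
    Finset.sum_le_sum fun q hq => by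
      have hq' := Finset.mem_range.1 hq
      exact (h.cheapest q hq').2 _ (hψ q hq')
  have h2 : ∑ v ∈ Finset.range k, (penalty f M (bal a σ φ j v) +
      ρ v * ((bal a σ ψ j v : ℝ) - bal a σ φ j v)) ≤
      ∑ v ∈ Finset.range k, penalty f M (bal a σ ψ j v) :=
    Finset.sum_le_sum fun v hv => by
      have hv' := Finset.mem_range.1 hv
      exact penalty_subgradient hM (h.slope_le v hv') (h.le_slope v hv') _
  simp only [mul_sub, Finset.sum_add_distrib, Finset.sum_sub_distrib] at h1 h2
  rw [sum_price hψ, sum_price fun q hq => (h.cheapest q hq).1] at h2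
  linarith

/-- If the penalty constant exceeds the total weight, a certified assignment is balanced as soon as
some assignment is. -/
theorem Certificate.balanced {a k j : ℕ} {σ φ : ℕ → ℕ} {W : ℕ → ℕ → ℝ} {f : ℕ} {M : ℝ} {ρ : ℕ → ℝ}
    (h : Certificate a k j σ W f M φ ρ) (hW : ∀ q < j, ∀ v < k, 0 ≤ W q v)
    (hM : ∑ q ∈ Finset.range j, ∑ v ∈ Finset.range k, W q v < M)
    {ψ : ℕ → ℕ} (hψ : ∀ q < j, ψ q < k) (hb : ∀ v < k, |bal a σ ψ j v| ≤ f) :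
    ∀ v < k, |bal a σ φ j v| ≤ f := by
  have hM0 : 0 ≤ M := le_trans (Finset.sum_nonneg fun q hq => Finset.sum_nonneg fun v hv =>
    hW q (Finset.mem_range.1 hq) v (Finset.mem_range.1 hv)) hM.le
  have h1 := h.optimal hM0 hψ
  rw [Finset.sum_eq_zero (s := Finset.range k) (f := fun v => penalty f M (bal a σ ψ j v))
    fun v hv => penalty_eq_zero M (hb v (Finset.mem_range.1 hv)), add_zero] at h1
  have h2 : ∑ q ∈ Finset.range j, W q (ψ q) ≤
      ∑ q ∈ Finset.range j, ∑ v ∈ Finset.range k, W q v :=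
    Finset.sum_le_sum fun q hq => Finset.single_le_sum (f := W q)
      (fun v hv => hW q (Finset.mem_range.1 hq) v (Finset.mem_range.1 hv))
      (Finset.mem_range.2 (hψ q (Finset.mem_range.1 hq)))
  have h3 : 0 ≤ ∑ q ∈ Finset.range j, W q (φ q) := Finset.sum_nonneg fun q hq =>
    hW q (Finset.mem_range.1 hq) _ (h.cheapest q (Finset.mem_range.1 hq)).1
  intro v hv
  by_contra hc
  have h4 := le_penalty hM0 hc
  have h5 := Finset.single_le_sum (f := fun v => penalty f M (bal a σ φ j v))
    (fun v _ => penalty_nonneg hM0 f _) (Finset.mem_range.2 hv)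
  linarith

theorem Certificate.sum_le {a k j : ℕ} {σ φ : ℕ → ℕ} {W : ℕ → ℕ → ℝ} {f : ℕ} {M : ℝ} {ρ : ℕ → ℝ}
    (h : Certificate a k j σ W f M φ ρ) (hM : 0 ≤ M)
    {ψ : ℕ → ℕ} (hψ : ∀ q < j, ψ q < k) (hb : ∀ v < k, |bal a σ ψ j v| ≤ f) :
    ∑ q ∈ Finset.range j, W q (φ q) ≤ ∑ q ∈ Finset.range j, W q (ψ q) := by
  have h1 := h.optimal hM hψ
  rw [Finset.sum_eq_zero (s := Finset.range k) (f := fun v => penalty f M (bal a σ ψ j v))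
    fun v hv => penalty_eq_zero M (hb v (Finset.mem_range.1 hv)), add_zero] at h1
  have : 0 ≤ ∑ v ∈ Finset.range k, penalty f M (bal a σ φ j v) :=
    Finset.sum_nonneg fun v _ => penalty_nonneg hM f _
  linarith

/-! ### Shortest paths in the exchange graph -/

/-- Moving point `q` is an arc from center `u` to center `v`: it carries one unit of imbalance,
counted relative to the attribute `a`, from `u` to `v`. -/
def Arc (a : ℕ) (σ φ : ℕ → ℕ) (u v q : ℕ) : Prop :=
  (σ q = a ∧ φ q = u) ∨ (σ q ≠ a ∧ φ q = v)

/-- The increase of the weight when point `q` is moved along an arc from `u` to `v`. -/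
def arcWeight (a : ℕ) (σ : ℕ → ℕ) (W : ℕ → ℕ → ℝ) (u v q : ℕ) : ℝ :=
  if σ q = a then W q v - W q u else W q u - W q v

/-- With respect to a certificate, reduced arc weights are nonnegative. -/
theorem Cheapest.le_arc {a k j : ℕ} {σ φ : ℕ → ℕ} {W : ℕ → ℕ → ℝ} {ρ : ℕ → ℝ}
    (h : Cheapest a k j σ W φ ρ) {u v q : ℕ} (hu : u < k) (hv : v < k) (hq : q < j)
    (ha : Arc a σ φ u v q) : ρ u ≤ arcWeight a σ W u v q + ρ v := by
  obtain ⟨-, h2⟩ := h q hq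
  rcases ha with ⟨h1, rfl⟩ | ⟨h1, rfl⟩
  · have := h2 v hv
    simp only [sgn, arcWeight, h1, if_true] at this ⊢
    push_cast at this
    linarith
  · have := h2 u hu
    simp only [sgn, arcWeight, h1, if_false] at this ⊢
    push_cast at this
    linarith

theorem cheapest_of_le_arc {a k j : ℕ} {σ φ : ℕ → ℕ} {W : ℕ → ℕ → ℝ} {ρ : ℕ → ℝ}
    (hφ : ∀ q < j, φ q < k)
    (h : ∀ u < k, ∀ v < k, ∀ q < j, Arc a σ φ u v q → ρ u ≤ arcWeight a σ W u v q + ρ v) :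
    Cheapest a k j σ W φ ρ := by
  intro q hq
  refine ⟨hφ q hq, fun i hi => ?_⟩
  by_cases h1 : σ q = a
  · have := h (φ q) (hφ q hq) i hi q hq (Or.inl ⟨h1, rfl⟩)
    simp only [sgn, arcWeight, h1, if_true] at this ⊢
    push_cast
    linarith
  · have := h i hi (φ q) (hφ q hq) q hq (Or.inr ⟨h1, rfl⟩)
    simp only [sgn, arcWeight, h1, if_false] at this ⊢
    push_cast
    linarith

/-- Dijkstra's algorithm for the distances `D` from the point `j` to the centers `v < k`, with
reduced weights given by the prices `ρ`, between two rounds: `r` centers have been visited, and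
`rank` numbers them by `1, …, r`, being `0` at the others. The tentative shortest path to `v` ends
with the arc from `pc v` that moves the point `pp v` if `hp v ≠ 0`, and starts at `v` otherwise. In
the round in progress the center `u` was visited last, and the arcs in `P` out of `u` have been
relaxed; `P` holds everywhere if no round is in progress. -/
structure Dijkstra (a k j : ℕ) (σ φ : ℕ → ℕ) (W : ℕ → ℕ → ℝ) (ρ : ℕ → ℝ) (r u : ℕ)
    (P : ℕ → ℕ → Prop) (D : ℕ → ℝ) (rank hp pc pp : ℕ → ℕ) : Prop where
  start : ∀ v < k, D v ≤ W j v
  root : ∀ v < k, hp v = 0 → D v = W j v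
  pred : ∀ v < k, hp v ≠ 0 → pc v < k ∧ pp v < j ∧ Arc a σ φ (pc v) v (pp v) ∧
    D v = D (pc v) + arcWeight a σ W (pc v) v (pp v) ∧ rank (pc v) ≠ 0 ∧
    (rank v = 0 ∨ rank (pc v) < rank v)
  rank_le : ∀ v < k, rank v ≤ r
  card : ((Finset.range k).filter fun v => rank v ≠ 0).card = r
  order : ∀ w < k, ∀ v < k, rank w ≠ 0 → rank v = 0 → D w + ρ w ≤ D v + ρ v
  relaxed : ∀ w < k, ∀ v < k, ∀ q < j, rank w ≠ 0 → Arc a σ φ w v q → (w = u → P q v) →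
    D v ≤ D w + arcWeight a σ W w v q
  last : r ≠ 0 → u < k ∧ rank u ≠ 0 ∧ ∀ w < k, rank w ≠ 0 → D w + ρ w ≤ D u + ρ u

section Dijkstra

variable {a k j : ℕ} {σ φ : ℕ → ℕ} {W : ℕ → ℕ → ℝ} {ρ : ℕ → ℝ} {r u : ℕ}
  {P : ℕ → ℕ → Prop} {D : ℕ → ℝ} {rank hp pc pp : ℕ → ℕ}

theorem dijkstra_init (hD : ∀ v < k, D v = W j v) (hr : ∀ v < k, rank v = 0)
    (hh : ∀ v < k, hp v = 0) (u : ℕ) (P : ℕ → ℕ → Prop) :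
    Dijkstra a k j σ φ W ρ 0 u P D rank hp pc pp where
  start v hv := (hD v hv).le
  root v hv _ := hD v hv
  pred v hv h := absurd (hh v hv) h
  rank_le v hv := (hr v hv).le
  card := by
    rw [Finset.card_eq_zero, Finset.filter_eq_empty_iff]
    intro v hv
    simpa using hr v (Finset.mem_range.1 hv)
  order w hw _ _ h := absurd (hr w hw) h
  relaxed w hw _ _ _ _ h := absurd (hr w hw) h
  last h := absurd rfl h

/-- Less may be claimed about the relaxed arcs. -/
theorem Dijkstra.congr {P' : ℕ → ℕ → Prop} (h : Dijkstra a k j σ φ W ρ r u P D rank hp pc pp)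
    (hP : ∀ q < j, ∀ v < k, P' q v → P q v) : Dijkstra a k j σ φ W ρ r u P' D rank hp pc pp :=
  { h with
    relaxed := fun w hw v hv q hq h1 h2 h3 =>
      h.relaxed w hw v hv q hq h1 h2 fun e => hP q hq v hv (h3 e) }

theorem Dijkstra.exists_unvisited (h : Dijkstra a k j σ φ W ρ r u P D rank hp pc pp)
    (hr : r < k) : ∃ v < k, rank v = 0 := by
  by_contra! hc
  have := h.card
  rw [Finset.filter_true_of_mem fun v hv => hc v (Finset.mem_range.1 hv), Finset.card_range] at this
  omega

theorem Dijkstra.visited (h : Dijkstra a k j σ φ W ρ k u P D rank hp pc pp) :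
    ∀ v < k, rank v ≠ 0 := by
  have h1 : (Finset.range k).filter (fun v => rank v ≠ 0) = Finset.range k :=
    Finset.eq_of_subset_of_card_le (Finset.filter_subset _ _) (by rw [h.card, Finset.card_range])
  intro v hv
  have := Finset.mem_range.2 hv
  rw [← h1] at this
  exact (Finset.mem_filter.1 this).2

/-- A new round begins: an unvisited center of smallest reduced distance is visited. -/
theorem Dijkstra.visit (h : Dijkstra a k j σ φ W ρ r u (fun _ _ => True) D rank hp pc pp)
    {u' : ℕ} (hu : u' < k) (hr : rank u' = 0)
    (hmin : ∀ v < k, rank v = 0 → D u' + ρ u' ≤ D v + ρ v) :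
    Dijkstra a k j σ φ W ρ (r + 1) u' (fun _ _ => False) D (Function.update rank u' (r + 1))
      hp pc pp where
  start := h.start
  root := h.root
  pred v hv hh := by
    obtain ⟨h1, h2, h3, h4, h5, h6⟩ := h.pred v hv hh
    have hne : pc v ≠ u' := by rintro e; rw [e] at h5; exact h5 hr
    refine ⟨h1, h2, h3, h4, by rwa [Function.update_of_ne hne], ?_⟩
    rw [Function.update_of_ne hne]
    by_cases hv' : v = u'
    · subst hv'
      right
      rw [Function.update_self]
      have := h.rank_le _ h1
      omega
    · rwa [Function.update_of_ne hv']
  rank_le v hv := by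
    by_cases hv' : v = u'
    · rw [hv', Function.update_self]
    · rw [Function.update_of_ne hv']
      have := h.rank_le _ hv
      omega
  card := by
    have : (Finset.range k).filter (fun v => Function.update rank u' (r + 1) v ≠ 0) =
        insert u' ((Finset.range k).filter fun v => rank v ≠ 0) := by
      ext v
      by_cases hv' : v = u'
      · simp [hv', hu]
      · simp [hv']
    rw [this, Finset.card_insert_of_notMem (by simp [hr]), h.card]
  order w hw v hv h1 h2 := by
    have hv' : v ≠ u' := by rintro rfl; simp at h2
    rw [Function.update_of_ne hv'] at h2
    by_cases hw' : w = u'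
    · rw [hw']
      exact hmin v hv h2
    · rw [Function.update_of_ne hw'] at h1
      exact h.order w hw v hv h1 h2
  relaxed w hw v hv q hq h1 h2 h3 := by
    by_cases hw' : w = u'
    · exact (h3 hw').elim
    · rw [Function.update_of_ne hw'] at h1
      exact h.relaxed w hw v hv q hq h1 h2 fun _ => trivial
  last _ := by
    refine ⟨hu, by simp, fun w hw h1 => ?_⟩
    by_cases hw' : w = u'
    · rw [hw']
    · rw [Function.update_of_ne hw'] at h1
      exact h.order w hw u' hu h1 hr

/-- An arc `(q, v)` out of `u` is relaxed without effect. -/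
theorem Dijkstra.skip (h : Dijkstra a k j σ φ W ρ r u P D rank hp pc pp) {v q : ℕ}
    (hs : Arc a σ φ u v q → D v ≤ D u + arcWeight a σ W u v q) :
    Dijkstra a k j σ φ W ρ r u (fun q' v' => P q' v' ∨ (q' = q ∧ v' = v)) D rank hp pc pp :=
  { h with
    relaxed := fun w hw v' hv q' hq h1 h2 h3 => by
      by_cases hw' : w = u
      · rcases h3 hw' with h4 | ⟨rfl, rfl⟩
        · exact h.relaxed w hw v' hv q' hq h1 h2 fun _ => h4
        · subst hw'; exact hs h2
      · exact h.relaxed w hw v' hv q' hq h1 h2 fun e => absurd e hw' }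

/-- An arc `(q, v)` out of `u` is relaxed and improves the distance of `v`. As the reduced weights
are nonnegative, `v` is unvisited. -/
theorem Dijkstra.relax (h : Dijkstra a k j σ φ W ρ r u P D rank hp pc pp) (hr : r ≠ 0)
    (hφ : Cheapest a k j σ W φ ρ) {v q c : ℕ} (hc : c ≠ 0) (hv : v < k) (hq : q < j)
    (harc : Arc a σ φ u v q) (hlt : D u + arcWeight a σ W u v q < D v) :
    Dijkstra a k j σ φ W ρ r u (fun q' v' => P q' v' ∨ (q' = q ∧ v' = v))
      (Function.update D v (D u + arcWeight a σ W u v q)) rank (Function.update hp v c)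
      (Function.update pc v u) (Function.update pp v q) := by
  obtain ⟨hu, hru, hlast⟩ := h.last hr
  have hred := hφ.le_arc hu hv hq harc
  have hrv : rank v = 0 := by
    by_contra hne
    have := hlast v hv hne
    linarith
  have hne : ∀ w, rank w ≠ 0 → w ≠ v := by rintro w hw rfl; exact hw hrv
  have hle : ∀ w, Function.update D v (D u + arcWeight a σ W u v q) w ≤ D w := by
    intro w
    by_cases hw : w = v
    · rw [hw, Function.update_self]; exact hlt.le
    · rw [Function.update_of_ne hw]
  refine ⟨fun w hw => (hle w).trans (h.start w hw), fun w hw hh => ?_, fun w hw hh => ?_, h.rank_le,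
    h.card, fun w hw x hx h1 h2 => ?_, fun w hw x hx q' hq' h1 h2 h3 => ?_, fun _ => ?_⟩
  · have hwv : w ≠ v := by rintro rfl; simp [hc] at hh
    rw [Function.update_of_ne hwv] at hh ⊢
    exact h.root w hw hh
  · by_cases hwv : w = v
    · subst hwv
      simp only [Function.update_self]
      rw [Function.update_of_ne (hne u hru)]
      exact ⟨hu, hq, harc, rfl, hru, Or.inl hrv⟩
    · simp only [Function.update_of_ne hwv] at hh ⊢
      obtain ⟨h1, h2, h3, h4, h5, h6⟩ := h.pred w hw hh
      rw [Function.update_of_ne (hne _ h5)]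
      exact ⟨h1, h2, h3, h4, h5, h6⟩
  · rw [Function.update_of_ne (hne w h1)]
    by_cases hxv : x = v
    · subst hxv
      rw [Function.update_self]
      have := hlast w hw h1
      linarith
    · rw [Function.update_of_ne hxv]
      exact h.order w hw x hx h1 h2
  · rw [Function.update_of_ne (hne w h1)]
    by_cases hw' : w = u
    · subst hw'
      rcases h3 rfl with h4 | ⟨rfl, rfl⟩
      · exact (hle x).trans (h.relaxed w hw x hx q' hq' h1 h2 fun _ => h4)
      · rw [Function.update_self]
    · exact (hle x).trans (h.relaxed w hw x hx q' hq' h1 h2 fun e => absurd e hw')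
  · refine ⟨hu, hru, fun w hw h1 => ?_⟩
    rw [Function.update_of_ne (hne w h1), Function.update_of_ne (hne u hru)]
    exact hlast w hw h1

end Dijkstra

/-! ### Augmentation along a shortest path -/

/-- Walking back along the shortest path to the center `e`, whose cost including the slope of the
penalty at `e` is `H`: the points on the part of the path behind `x` have been moved, at most
`s` vertices remain, and an extra unit of imbalance waits at `x`. -/
structure Augmenting (a k j : ℕ) (σ φ₀ : ℕ → ℕ) (W : ℕ → ℕ → ℝ) (ρ D : ℕ → ℝ)
    (rank hp pc pp : ℕ → ℕ) (H : ℝ) (e s x : ℕ) (φ : ℕ → ℕ) : Prop where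
  lt : x < k
  rank_le : hp x = 0 ∨ rank x ≤ s
  price_le : ρ x ≤ H - D x
  cheapest : Cheapest a k j σ W φ fun v => max (ρ v) (H - D v)
  bal_eq : ∀ y, bal a σ φ j y + (if y = x then 1 else 0) =
    bal a σ φ₀ j y + (if y = e then 1 else 0)
  arc : ∀ y < k, rank y ≤ rank x → hp y ≠ 0 → Arc a σ φ (pc y) y (pp y)

theorem bal_update {a j : ℕ} {σ φ : ℕ → ℕ} {q : ℕ} (hq : q < j) (i y : ℕ) :
    bal a σ (Function.update φ q i) j y = bal a σ φ j y
      - (if φ q = y then sgn a σ q else 0) + (if i = y then sgn a σ q else 0) := by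
  have hm := Finset.mem_range.2 hq
  unfold bal
  rw [← Finset.add_sum_erase _ _ hm, ← Finset.add_sum_erase (Finset.range j) _ hm,
    Function.update_self,
    Finset.sum_congr rfl fun w hw => by
      rw [Function.update_of_ne (Finset.ne_of_mem_erase hw)]]
  ring

theorem bal_succ {a j : ℕ} {σ φ : ℕ → ℕ} (x y : ℕ) :
    bal a σ (Function.update φ j x) (j + 1) y =
      bal a σ φ j y + if x = y then sgn a σ j else 0 := by
  unfold bal
  rw [Finset.sum_range_succ, Function.update_self]
  congr 1
  refine Finset.sum_congr rfl fun q hq => ?_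
  rw [Function.update_of_ne (Finset.mem_range.1 hq).ne]

section Augment

variable {a k j : ℕ} {σ φ φ₀ : ℕ → ℕ} {W : ℕ → ℕ → ℝ} {ρ : ℕ → ℝ} {f : ℕ} {M : ℝ} {u : ℕ}
  {P : ℕ → ℕ → Prop} {D : ℕ → ℝ} {rank hp pc pp : ℕ → ℕ} {H : ℝ} {e s x : ℕ}

/-- The prices `max (ρ v) (H - D v)` certify the old assignment no less than `ρ` does, and make all
arcs on the shortest path tight. The maximum truncates the distances at the end of the path, which
keeps the slope conditions at the other centers. -/
theorem augmenting_init (hC : Certificate a k j σ W f M φ₀ ρ)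
    (hD : Dijkstra a k j σ φ₀ W ρ k u (fun _ _ => True) D rank hp pc pp) (he : e < k)
    (hH : H = D e + slope f M (bal a σ φ₀ j e)) :
    Augmenting a k j σ φ₀ W ρ D rank hp pc pp H e k e φ₀ where
  lt := he
  rank_le := Or.inr (hD.rank_le e he)
  price_le := by
    have := hC.le_slope e he
    linarith
  cheapest := by
    refine cheapest_of_le_arc (fun q hq => (hC.cheapest q hq).1) fun v hv w hw q hq harc => ?_
    have h1 := hC.cheapest.le_arc hv hw hq harc
    have h2 := hD.relaxed v hv w hw q hq (hD.visited v hv) harc fun _ => trivial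
    refine max_le (h1.trans ?_) (le_trans (b := arcWeight a σ W v w q + (H - D w)) ?_ ?_)
    · have := le_max_left (ρ w) (H - D w)
      linarith
    · linarith
    · have := le_max_right (ρ w) (H - D w)
      linarith
  bal_eq y := rfl
  arc y hy _ hh := (hD.pred y hy hh).2.2.1

/-- One step back along the path: the point of the arc that enters `x` is moved. It keeps
sitting at a cheapest center, since the arc is tight. The arcs on the rest of the path move other
points, since `rank` decreases along it. -/
theorem Augmenting.step (h : Augmenting a k j σ φ₀ W ρ D rank hp pc pp H e (s + 1) x φ)
    (hC : Certificate a k j σ W f M φ₀ ρ)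
    (hD : Dijkstra a k j σ φ₀ W ρ k u (fun _ _ => True) D rank hp pc pp) (hx : hp x ≠ 0) :
    Augmenting a k j σ φ₀ W ρ D rank hp pc pp H e s (pc x)
      (Function.update φ (pp x) (if σ (pp x) = a then x else pc x)) := by
  obtain ⟨hpc, hpp, harc0, hDx, -, hrank⟩ := hD.pred x h.lt hx
  have hrank : rank (pc x) < rank x := hrank.resolve_left (hD.visited x h.lt)
  have harc := h.arc x h.lt le_rfl hx
  have hle : ρ (pc x) ≤ H - D (pc x) := by
    have := hC.cheapest.le_arc hpc h.lt hpp harc0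
    have := h.price_le
    linarith
  have m1 := max_eq_right hle
  have m2 := max_eq_right h.price_le
  have hne : x ≠ pc x := by intro e; rw [← e] at hrank; exact lt_irrefl _ hrank
  refine ⟨hpc, ?_, hle, fun q hq => ?_, fun y => ?_, fun y hy hr hh => ?_⟩
  · rcases h.rank_le with h1 | h1
    · exact absurd h1 hx
    · right; omega
  · by_cases hqp : q = pp x
    · subst hqp
      rw [Function.update_self]
      have hopt := (h.cheapest _ hpp).2
      rcases harc with ⟨h1, h2⟩ | ⟨h1, h2⟩
      · rw [if_pos h1]
        refine ⟨h.lt, fun i hi => le_trans (le_of_eq ?_) (hopt i hi)⟩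
        simp only [arcWeight, sgn, h1, if_true] at hDx ⊢
        rw [h2, m1, m2]
        push_cast
        linarith
      · rw [if_neg h1]
        refine ⟨hpc, fun i hi => le_trans (le_of_eq ?_) (hopt i hi)⟩
        simp only [arcWeight, sgn, h1, if_false] at hDx ⊢
        rw [h2, m1, m2]
        push_cast
        linarith
    · rw [Function.update_of_ne hqp]
      exact h.cheapest q hq
  · rw [← h.bal_eq y, bal_update hpp]
    rcases harc with ⟨h1, h2⟩ | ⟨h1, h2⟩
    · simp only [h1, h2, sgn, if_true, eq_comm (a := y)]
      ring
    · simp only [h1, h2, sgn, if_false, eq_comm (a := y)]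
      split_ifs <;> omega
  · have harcy := h.arc y hy (by omega) hh
    by_cases hqp : pp y = pp x
    · exfalso
      have hry := (hD.pred y hy hh).2.2.2.2.2.resolve_left (hD.visited y hy)
      rw [Arc, hqp] at harcy
      rcases harc with ⟨h1, h2⟩ | ⟨h1, h2⟩ <;> rcases harcy with ⟨h3, h4⟩ | ⟨h3, h4⟩
      · rw [← h4, h2] at hry; omega
      · exact h3 h1
      · exact h1 h3
      · rw [← h4, h2] at hr; omega
    · rw [Arc, Function.update_of_ne hqp]
      exact harcy

/-- At the start of the path the new point `j` is inserted. The price of the end `e` is the slope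
of the penalty to the right of its old imbalance, hence to the left of the new one. -/
theorem Augmenting.finish (h : Augmenting a k j σ φ₀ W ρ D rank hp pc pp H e 0 x φ) (hM : 0 ≤ M)
    (hC : Certificate a k j σ W f M φ₀ ρ)
    (hD : Dijkstra a k j σ φ₀ W ρ k u (fun _ _ => True) D rank hp pc pp) (he : e < k)
    (hH : H = D e + slope f M (bal a σ φ₀ j e))
    (hmin : ∀ v < k, H ≤ D v + slope f M (bal a σ φ₀ j v)) (hj : σ j = a) :
    Certificate a k (j + 1) σ W f M (Function.update φ j x) (fun v => max (ρ v) (H - D v)) := by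
  have hx : hp x = 0 := h.rank_le.resolve_right (by have := hD.visited x h.lt; omega)
  have hs : sgn a σ j = 1 := by simp [sgn, hj]
  have hbal : ∀ y, bal a σ (Function.update φ j x) (j + 1) y =
      bal a σ φ₀ j y + if y = e then 1 else 0 := by
    intro y
    rw [bal_succ, hs, ← h.bal_eq y]
    simp only [eq_comm]
  refine ⟨fun q hq => ?_, fun v hv => ?_, fun v hv => ?_⟩
  · by_cases hqj : q = j
    · subst hqj
      rw [Function.update_self, hs]
      refine ⟨h.lt, fun i hi => ?_⟩
      rw [max_eq_right h.price_le, hD.root x h.lt hx]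
      have h1 := hD.start i hi
      have h2 := le_max_right (ρ i) (H - D i)
      push_cast
      linarith
    · rw [Function.update_of_ne hqj]
      exact h.cheapest q (by omega)
  · rw [hbal]
    by_cases hve : v = e
    · subst hve
      rw [if_pos rfl, add_sub_cancel_right]
      exact le_max_of_le_right (by linarith)
    · rw [if_neg hve, add_zero]
      exact le_max_of_le_left (hC.slope_le v hv)
  · refine le_trans (max_le (hC.le_slope v hv) ?_) (slope_mono hM (?_ : bal a σ φ₀ j v ≤ _))
    · have := hmin v hv
      linarith
    · rw [hbal]
      split_ifs <;> omega

end Augment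

/-! ### The program

Scalar variables are kept in the cell `(0, 0)` of an array of their own, vectors in row `0`.
Besides the input and the output, the natural arrays are

* `4`: the assignment, `5`, `6`: the bound `f` on the imbalance and the current point `j`,
* `7`: the attribute `a` of the current point,
* `8`: the imbalance of cluster `v` relative to the attribute `a` is the difference of the cells
  `(a, v)` and `(1 - a, v)`,
* `9`, `10`, `11`, `12`: the vectors `rank`, `hp`, `pc`, `pp` of `Dijkstra`,
* `13`: the center visited last, `17`: the end of the shortest path, `19`: the vertex reached when
  walking back along it, `20`: the bit telling whether the clustering obeys the bound `f`,
* `14`, `15`, `16`, `18`, `21`, `22`, `23`: loop counters.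

The real arrays are `1`: the weights, `2`: the penalty constant, `3`: the prices relative to the
attribute `a` in row `a`, `4`: the distances, `5`: the distances plus the slopes of the penalty,
`6`: the cost of the current clustering, `7`: that of the last listed one, `8`: an accumulator. -/

/-- The entry `e` of the natural vector `a`. -/
abbrev rowN (a : ℕ) (e : NExp) : NExp := .read a (.const 0) e

/-- The entry `e` of the real vector `a`. -/
abbrev rowR (a : ℕ) (e : NExp) : RExp := .read a (.const 0) e

/-- The real scalar variable `a`. -/
abbrev varR (a : ℕ) : RExp := .read a (.const 0) (.const 0)

/-- The assignment to a real scalar variable. -/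
abbrev setVarR (a : ℕ) (e : RExp) : Cmd := .setReal a (.const 0) (.const 0) e

/-- The number of centers. -/
abbrev kN : NExp := .read 0 (.const 1) (.const 0)

/-- The bit telling whether `p = ∞`. -/
abbrev bitN : NExp := .read 0 (.const 2) (.const 0)

/-- The attribute other than that of the current point. -/
abbrev coattr : NExp := .sub (.const 1) (var 7)

/-- The test of two natural numbers for equality. -/
abbrev natEq (e₁ e₂ : NExp) : BExp := .and (.natLe e₁ e₂) (.natLe e₂ e₁)

/-- Sequential composition. -/
infixr:30 " ;; " => Cmd.seq

/-- For `p = ∞`, computes the weight of the current point and center in the accumulator: it starts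
with `1`, and is doubled `n` times for every smaller contribution. -/
def ordinalWeight : Cmd :=
  setVarR 8 (.const 1) ;;
  forLoop 21 (var 0) (forLoop 22 kN (
    .ite (.realLe (.read 0 (var 6) (var 15)) (.read 0 (var 21) (var 22)))
      .skip
      (forLoop 23 (var 0) (setVarR 8 (.add (varR 8) (varR 8))))))

/-- Computes the weights and the penalty constant. -/
def weights : Cmd :=
  setVarR 2 (.const 1) ;;
  forLoop 6 (var 0) (forLoop 15 kN (
    .ite (.natLe (.const 1) bitN)
      ordinalWeight
      (setVarR 8 (.read 0 (var 6) (var 15))) ;;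
    .setReal 1 (var 6) (var 15) (varR 8) ;;
    setVarR 2 (.add (varR 2) (varR 8))))

/-- Finds the unvisited center of smallest reduced distance. -/
def selectNext : Cmd :=
  setVar 13 kN ;;
  forLoop 15 kN (
    .ite (.and (.natLe (rowN 9 (var 15)) (.const 0))
        (.not (.and (.natLe (.add (var 13) (.const 1)) kN)
          (.realLe (.add (rowR 4 (var 13)) (.read 3 (var 7) (var 13)))
            (.add (rowR 4 (var 15)) (.read 3 (var 7) (var 15)))))))
      (setVar 13 (var 15))
      .skip)

/-- Relaxes an arc of weight `w` that moves the current point `16` from `13` to `15`. -/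
def relaxArc (w : RExp) : Cmd :=
  .ite (.realLe (rowR 4 (var 15)) (.add (rowR 4 (var 13)) w))
    .skip
    (.setReal 4 (.const 0) (var 15) (.add (rowR 4 (var 13)) w) ;;
      .setNat 10 (.const 0) (var 15) (.const 1) ;;
      .setNat 11 (.const 0) (var 15) (var 13) ;;
      .setNat 12 (.const 0) (var 15) (var 16))

/-- Relaxes all arcs out of the center visited last. -/
def relaxAll : Cmd :=
  forLoop 16 (var 6) (forLoop 15 kN (
    .ite (natEq (.read 1 (var 16) (.const 0)) (var 7))
      (.ite (natEq (rowN 4 (var 16)) (var 13))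
        (relaxArc (.sub (.read 1 (var 16) (var 15)) (.read 1 (var 16) (var 13))))
        .skip)
      (.ite (natEq (rowN 4 (var 16)) (var 15))
        (relaxArc (.sub (.read 1 (var 16) (var 13)) (.read 1 (var 16) (var 15))))
        .skip)))

/-- Dijkstra's algorithm. -/
def shortestPaths : Cmd :=
  forLoop 15 kN (
    .setReal 4 (.const 0) (var 15) (.read 1 (var 6) (var 15)) ;;
    .setNat 9 (.const 0) (var 15) (.const 0) ;;
    .setNat 10 (.const 0) (var 15) (.const 0)) ;;
  forLoop 14 kN (
    selectNext ;;
    .setNat 9 (.const 0) (var 13) (.add (var 14) (.const 1)) ;;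
    relaxAll)

/-- Finds the best end for the augmenting path. -/
def chooseEnd : Cmd :=
  setVar 17 kN ;;
  forLoop 15 kN (
    .ite (.natLe (.add (.read 8 coattr (var 15)) (var 5)) (.read 8 (var 7) (var 15)))
      (.setReal 5 (.const 0) (var 15) (.add (rowR 4 (var 15)) (varR 2)))
      (.ite (.natLe (.add (.add (.read 8 (var 7) (var 15)) (var 5)) (.const 1))
          (.read 8 coattr (var 15)))
        (.setReal 5 (.const 0) (var 15) (.sub (rowR 4 (var 15)) (varR 2)))
        (.setReal 5 (.const 0) (var 15) (rowR 4 (var 15)))) ;;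
    .ite (.and (.natLe (.add (var 17) (.const 1)) kN)
        (.realLe (rowR 5 (var 17)) (rowR 5 (var 15))))
      .skip
      (setVar 17 (var 15)))

/-- Updates the prices and the imbalance of the cluster at the end of the path. -/
def updatePrices : Cmd :=
  forLoop 15 kN (
    .ite (.realLe (.read 3 (var 7) (var 15)) (.sub (rowR 5 (var 17)) (rowR 4 (var 15))))
      (.setReal 3 (var 7) (var 15) (.sub (rowR 5 (var 17)) (rowR 4 (var 15))))
      .skip ;;
    .setReal 3 coattr (var 15) (.sub (.const 0) (.read 3 (var 7) (var 15)))) ;;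
  .setNat 8 (var 7) (var 17) (.add (.read 8 (var 7) (var 17)) (.const 1))

/-- Moves the points along the path, and inserts the current point. -/
def augment : Cmd :=
  setVar 19 (var 17) ;;
  forLoop 18 kN (
    .ite (.natLe (.const 1) (rowN 10 (var 19)))
      (.ite (natEq (.read 1 (rowN 12 (var 19)) (.const 0)) (var 7))
        (.setNat 4 (.const 0) (rowN 12 (var 19)) (var 19))
        (.setNat 4 (.const 0) (rowN 12 (var 19)) (rowN 11 (var 19))) ;;
      setVar 19 (rowN 11 (var 19)))
      .skip) ;;
  .setNat 4 (.const 0) (var 6) (var 19)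

/-- Inserts the current point. -/
def insertPoint : Cmd :=
  setVar 7 (.read 1 (var 6) (.const 0)) ;;
  shortestPaths ;; chooseEnd ;; augment ;; updatePrices

/-- Computes an optimal assignment under the bound `f` on the imbalance. -/
def assign : Cmd :=
  forLoop 15 kN (
    .setNat 8 (.const 0) (var 15) (.const 0) ;;
    .setNat 8 (.const 1) (var 15) (.const 0) ;;
    .setReal 3 (.const 0) (var 15) (.const 0) ;;
    .setReal 3 (.const 1) (var 15) (.const 0)) ;;
  forLoop 6 (var 0) insertPoint

/-- Checks whether the current assignment obeys the bound `f` on the imbalance. -/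
def checkBound : Cmd :=
  setVar 20 (.const 1) ;;
  forLoop 15 kN (
    .ite (.and (.natLe (.read 8 (.const 0) (var 15)) (.add (.read 8 (.const 1) (var 15)) (var 5)))
        (.natLe (.read 8 (.const 1) (var 15)) (.add (.read 8 (.const 0) (var 15)) (var 5))))
      .skip
      (setVar 20 (.const 0)))

/-- Computes the maximum or the sum of the contributions. -/
def computeKey : Cmd :=
  setVarR 6 (.const 0) ;;
  forLoop 6 (var 0) (
    .ite (.natLe (.const 1) bitN)
      (.ite (.realLe (.read 0 (var 6) (rowN 4 (var 6))) (varR 6))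
        .skip
        (setVarR 6 (.read 0 (var 6) (rowN 4 (var 6)))))
      (setVarR 6 (.add (varR 6) (.read 0 (var 6) (rowN 4 (var 6))))))

/-- Appends the current assignment to the list. -/
def append : Cmd :=
  forLoop 6 (var 0) (.setNat 3 (var 2) (var 6) (rowN 4 (var 6))) ;;
  setVar 2 (.add (var 2) (.const 1)) ;;
  setVarR 7 (varR 6)

/-- One round: the bound `f` is treated. -/
def round : Cmd :=
  assign ;; checkBound ;; computeKey ;;
  .ite (.and (.natLe (.const 1) (var 20))
      (.not (.and (.natLe (.const 1) (var 2)) (.realLe (varR 7) (varR 6)))))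
    append
    .skip

/-- The program. Nothing is listed if there are points but no centers. -/
def paretoProgram : Cmd :=
  .ite (.and (.natLe kN (.const 0)) (.natLe (.const 1) (var 0)))
    .skip
    (weights ;; forLoop 5 (.add (var 0) (.const 1)) round)

/-! ### The weights -/

section Weights

/-- The number of contributions below `x`. -/
noncomputable def below (n k : ℕ) (d : ℕ → ℕ → ℝ) (x : ℝ) : ℕ :=
  ∑ q ∈ Finset.range n, ∑ v ∈ Finset.range k, if x ≤ d q v then 0 else 1

/-- The weights of which the program minimizes the sum: the contributions `d` themselves, or, for
`p = ∞`, powers of `2` in the order of the contributions, so far apart that `n` smaller ones do not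
make up for a larger one. -/
noncomputable def weight (b n k : ℕ) (d : ℕ → ℕ → ℝ) (q v : ℕ) : ℝ :=
  if 1 ≤ b then 2 ^ (n * below n k d (d q v)) else d q v

variable {N n k : ℕ}

attribute [local simp] State.putNat_nat_ne State.putReal_real_ne NExp.eval RExp.eval BExp.holds

theorem wp_ordinalWeight {m : State} (hn : m.nat 0 0 0 = n) (hk : m.nat 0 1 0 = k)
    (hN : n + k ≤ N) :
    Wp N ordinalWeight (fun m' => m'.real 8 0 0 =
      2 ^ (n * below n k (m.real 0) (m.real 0 (m.nat 6 0 0) (m.nat 15 0 0)))) m := by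
  refine wp_seq (wp_setReal ?_)
  refine wp_forLoop (B := n) (fun i m' => m'.real 8 0 0 = 2 ^ (n * ∑ q ∈ Finset.range i,
    ∑ v ∈ Finset.range k, if m.real 0 (m.nat 6 0 0) (m.nat 15 0 0) ≤ m.real 0 q v then 0 else 1))
    (by omega) rfl ?_ ?_ ?_ ?_
  · intro m' hF
    simp [hF.1 0 rfl, hn]
  · simp
  · intro q m1 hq hF hv hI
    refine wp_forLoop (B := k) (fun i m' => m'.real 8 0 0 = 2 ^ (n * (∑ q ∈ Finset.range q,
      (∑ v ∈ Finset.range k, if m.real 0 (m.nat 6 0 0) (m.nat 15 0 0) ≤ m.real 0 q v then 0 else 1)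
      + ∑ v ∈ Finset.range i, if m.real 0 (m.nat 6 0 0) (m.nat 15 0 0) ≤ m.real 0 q v then 0
        else 1)))
      (by omega) rfl ?_ ?_ ?_ ?_
    · intro m' hF'
      simp [hF'.1 0 rfl, hF.1 0 rfl, hk]
    · simpa using hI
    · intro v m2 hv' hF' hv2 hI2
      have e1 : m2.real 0 = m.real 0 := (hF'.2 0 rfl).trans (hF.2 0 rfl)
      have e2 : m2.nat 6 = m.nat 6 := (hF'.1 6 rfl).trans (hF.1 6 rfl)
      have e3 : m2.nat 15 = m.nat 15 := (hF'.1 15 rfl).trans (hF.1 15 rfl)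
      have e4 : m2.nat 0 0 0 = n := by rw [hF'.1 0 rfl, hF.1 0 rfl]; exact hn
      have e5 : m2.nat 21 0 0 = q := by rw [hF'.1 21 rfl, hv]
      refine wp_ite (fun hb => wp_skip ?_) fun hb => ?_
      · simp only [BExp.holds, RExp.eval, NExp.eval, e1, e2, e3, e5, hv2] at hb
        simpa [Finset.sum_range_succ, hb] using hI2
      · simp only [BExp.holds, RExp.eval, NExp.eval, e1, e2, e3, e5, hv2] at hb
        refine wp_forLoop (B := n) (fun i m' => m'.real 8 0 0 = m2.real 8 0 0 * 2 ^ i)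
          (by omega) rfl ?_ ?_ ?_ ?_
        · intro m' hF3
          simp [hF3.1 0 rfl, e4]
        · simp
        · intro i m3 hi hF3 hv3 hI3
          refine wp_setReal ?_
          simp [hI3]
          ring
        · intro m' hF3 hI3
          simp only [State.putNat_real, hI3, hI2]
          rw [Finset.sum_range_succ _ v, if_neg hb, ← pow_add]
          congr 1
    · intro m' hF' hI'
      simpa [Finset.sum_range_succ] using hI'
  · intro m' hF hI
    exact hI

theorem wp_weights {m : State} (hn : m.nat 0 0 0 = n) (hk : m.nat 0 1 0 = k) (hN : n + k ≤ N) :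
    Wp N weights (fun m' =>
      (∀ q < n, ∀ v < k, m'.real 1 q v = weight (m.nat 0 2 0) n k (m.real 0) q v) ∧
      m'.real 2 0 0 = 1 + ∑ q ∈ Finset.range n, ∑ v ∈ Finset.range k,
        weight (m.nat 0 2 0) n k (m.real 0) q v) m := by
  set w := weight (m.nat 0 2 0) n k (m.real 0) with hw
  refine wp_seq (wp_setReal ?_)
  refine wp_forLoop (B := n) (fun i m' => (∀ q < i, ∀ v < k, m'.real 1 q v = w q v) ∧
    m'.real 2 0 0 = 1 + ∑ q ∈ Finset.range i, ∑ v ∈ Finset.range k, w q v)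
    (by omega) rfl ?_ ?_ ?_ ?_
  · intro m' hF
    simp [hF.1 0 rfl, hn]
  · simp
  · intro q m1 hq hF hv hI
    refine wp_forLoop (B := k) (fun i m' => (∀ q' < q, ∀ v < k, m'.real 1 q' v = w q' v) ∧
      (∀ v < i, m'.real 1 q v = w q v) ∧
      m'.real 2 0 0 = 1 + (∑ q ∈ Finset.range q, ∑ v ∈ Finset.range k, w q v +
        ∑ v ∈ Finset.range i, w q v))
      (by omega) rfl ?_ ?_ ?_ ?_
    · intro m' hF'
      simp [hF'.1 0 rfl, hF.1 0 rfl, hk]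
    · simpa using hI
    · intro v m2 hv' hF' hv2 hI2
      have e0 : m2.nat 0 = m.nat 0 := (hF'.1 0 rfl).trans (hF.1 0 rfl)
      have e1 : m2.real 0 = m.real 0 := (hF'.2 0 rfl).trans (hF.2 0 rfl)
      have e6 : m2.nat 6 0 0 = q := by rw [hF'.1 6 rfl, hv]
      refine wp_seq ?_
      -- both branches leave the weight in the accumulator
      have step : ∀ m3 : State, Frame ordinalWeight m2 m3 → m3.real 8 0 0 = w q v →
          Wp N (.setReal 1 (var 6) (var 15) (varR 8) ;; setVarR 2 (.add (varR 2) (varR 8)))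
            (fun m' => (∀ q' < q, ∀ v < k, (m'.putNat 15 0 0 (v + 1)).real 1 q' v = w q' v) ∧
              (∀ v' < v + 1, (m'.putNat 15 0 0 (v + 1)).real 1 q v' = w q v') ∧
              (m'.putNat 15 0 0 (v + 1)).real 2 0 0 =
                1 + (∑ q ∈ Finset.range q, ∑ v ∈ Finset.range k, w q v +
                  ∑ v ∈ Finset.range (v + 1), w q v)) m3 := by
        intro m3 hF3 h8
        refine wp_seq (wp_setReal (wp_setReal ?_))
        have f6 : m3.nat 6 0 0 = q := by rw [hF3.1 6 rfl, e6]
        have f15 : m3.nat 15 0 0 = v := by rw [hF3.1 15 rfl, hv2]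
        have r1 := hF3.2 1 rfl
        have r2 := hF3.2 2 rfl
        simp only [NExp.eval, RExp.eval, f6, f15, h8]
        refine ⟨fun q' hq' v' hv' => ?_, fun v' hv' => ?_, ?_⟩
        · simp only [State.putNat_real]
          rw [State.putReal_real_ne _ _ _ _ (by decide), State.putReal_row_ne _ _ _ _ hq'.ne, r1]
          exact hI2.1 q' hq' v' hv'
        · simp only [State.putNat_real]
          rw [State.putReal_real_ne _ _ _ _ (by decide), State.putReal_row, r1]
          by_cases h : v' = v
          · rw [h, Function.update_self]
          · rw [Function.update_of_ne h]
            exact hI2.2.1 v' (by omega)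
        · simp [r2, hI2.2.2, Finset.sum_range_succ, h8]
          ring
      refine wp_ite (fun hb => ?_) fun hb => ?_
      · simp only [BExp.holds, NExp.eval, e0] at hb
        refine (wp_ordinalWeight (n := n) (k := k) (by rw [e0, hn]) (by rw [e0, hk]) hN).mono
          fun m3 hF3 h3 => step m3 hF3 ?_
        rw [h3, hw, weight, if_pos hb, e1, e6, hv2]
      · simp only [BExp.holds, NExp.eval, e0] at hb
        refine wp_setReal (step _ ⟨fun a ha => rfl, fun a ha =>
          State.putReal_real_ne _ _ _ _ (by rintro rfl; exact absurd ha (by decide))⟩ ?_)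
        simp [hw, weight, hb, e1, e6, hv2]
    · intro m' hF' hI'
      refine ⟨fun q' hq' v hv' => ?_, ?_⟩
      · rcases Nat.lt_succ_iff_lt_or_eq.1 hq' with h | rfl
        · exact hI'.1 q' h v hv'
        · exact hI'.2.1 v hv'
      · simpa [Finset.sum_range_succ] using hI'.2.2
  · intro m' hF hI
    exact hI

end Weights

/-! ### Insertion of a point -/

section Insertion

attribute [local simp] State.putNat_nat_ne State.putReal_real_ne NExp.eval RExp.eval BExp.holds

/-- The parts of the memory that stay fixed while the shortest paths are computed. -/
structure Inserting (k j a : ℕ) (σ φ : ℕ → ℕ) (W : ℕ → ℕ → ℝ) (ρ : ℕ → ℝ) (m : State) : Prop where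
  centers : m.nat 0 1 0 = k
  point : m.nat 6 0 0 = j
  attr : m.nat 7 0 0 = a
  attrs : ∀ q < j, m.nat 1 q 0 = σ q
  assignment : m.nat 4 0 = φ
  weights : m.real 1 = W
  prices : m.real 3 a = ρ

/-- The condition on `c` holds by `rfl` for concrete programs. -/
theorem Inserting.of_frame {k j a : ℕ} {σ φ : ℕ → ℕ} {W : ℕ → ℕ → ℝ} {ρ : ℕ → ℝ} {c : Cmd}
    {m m' : State} (h : Inserting k j a σ φ W ρ m) (hF : Frame c m m')
    (hc : (!(c.writesNat 0 || c.writesNat 1 || c.writesNat 4 || c.writesNat 6 || c.writesNat 7 ||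
      c.writesReal 1 || c.writesReal 3)) = true) : Inserting k j a σ φ W ρ m' := by
  simp only [Bool.not_eq_true', Bool.or_eq_false_iff] at hc
  obtain ⟨⟨⟨⟨⟨⟨h0, h1⟩, h4⟩, h6⟩, h7⟩, h1'⟩, h3⟩ := hc
  constructor
  · rw [hF.1 0 h0]; exact h.centers
  · rw [hF.1 6 h6]; exact h.point
  · rw [hF.1 7 h7]; exact h.attr
  · rw [hF.1 1 h1]; exact h.attrs
  · rw [hF.1 4 h4]; exact h.assignment
  · rw [hF.2 1 h1']; exact h.weights
  · rw [hF.2 3 h3]; exact h.prices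

/-- `Dijkstra` for the data in the memory. -/
abbrev DijkstraIn (a k j : ℕ) (σ φ : ℕ → ℕ) (W : ℕ → ℕ → ℝ) (ρ : ℕ → ℝ) (r : ℕ)
    (P : ℕ → ℕ → Prop) (m : State) : Prop :=
  Dijkstra a k j σ φ W ρ r (m.nat 13 0 0) P (m.real 4 0) (m.nat 9 0) (m.nat 10 0) (m.nat 11 0)
    (m.nat 12 0)

variable {N k j a : ℕ} {σ φ : ℕ → ℕ} {W : ℕ → ℕ → ℝ} {ρ : ℕ → ℝ} {m : State}

theorem wp_selectNext (hE : Inserting k j a σ φ W ρ m) (hN : k ≤ N)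
    (hex : ∃ v < k, m.nat 9 0 v = 0) :
    Wp N selectNext (fun m' => m'.nat 13 0 0 < k ∧ m.nat 9 0 (m'.nat 13 0 0) = 0 ∧
      ∀ v < k, m.nat 9 0 v = 0 → m.real 4 0 (m'.nat 13 0 0) + ρ (m'.nat 13 0 0) ≤
        m.real 4 0 v + ρ v) m := by
  refine wp_seq (wp_setNat ?_)
  refine wp_forLoop (B := k) (fun i m' =>
    (m'.nat 13 0 0 = k ∧ ∀ v < i, m.nat 9 0 v ≠ 0) ∨
    (m'.nat 13 0 0 < k ∧ m.nat 9 0 (m'.nat 13 0 0) = 0 ∧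
      ∀ v < i, m.nat 9 0 v = 0 → m.real 4 0 (m'.nat 13 0 0) + ρ (m'.nat 13 0 0) ≤
        m.real 4 0 v + ρ v)) (by omega) rfl ?_ ?_ ?_ ?_
  · intro m' hF
    simp [hF.1 0 rfl, hE.centers]
  · simp [hE.centers]
  · intro v m1 hv hF hv1 hI
    have e0 : m1.nat 0 1 0 = k := by rw [hF.1 0 rfl]; simp [hE.centers]
    have e7 : m1.nat 7 0 0 = a := by rw [hF.1 7 rfl]; simp [hE.attr]
    have e9 : m1.nat 9 = m.nat 9 := by rw [hF.1 9 rfl]; simp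
    have e4 : m1.real 4 = m.real 4 := by rw [hF.2 4 rfl]; simp
    have e3 : m1.real 3 a = ρ := by rw [hF.2 3 rfl]; simp [hE.prices]
    refine wp_ite (fun hb => wp_setNat ?_) fun hb => wp_skip ?_
    · simp only [BExp.holds, NExp.eval, RExp.eval, e0, e7, e9, e4, e3, hv1] at hb
      obtain ⟨h1, h2⟩ := hb
      right
      simp only [NExp.eval, hv1, State.putNat_nat_ne _ _ _ _ (show 13 ≠ 15 by decide),
        State.putNat_row, Function.update_self]
      refine ⟨hv, by omega, fun v' hv' h0 => ?_⟩
      rcases Nat.lt_succ_iff_lt_or_eq.1 hv' with h | rfl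
      · rcases hI with ⟨-, h3⟩ | ⟨h3, h4, h5⟩
        · exact absurd h0 (h3 v' h)
        · have h6 := h5 v' h h0
          have h7 : ¬ _ ≤ _ := fun h7 => h2 ⟨by omega, h7⟩
          linarith
      · exact le_rfl
    · simp only [BExp.holds, NExp.eval, RExp.eval, e0, e7, e9, e4, e3, hv1] at hb
      simp only [State.putNat_nat_ne _ _ _ _ (show 13 ≠ 15 by decide)]
      rcases hI with ⟨h3, h4⟩ | ⟨h3, h4, h5⟩
      · left
        refine ⟨h3, fun v' hv' => ?_⟩
        rcases Nat.lt_succ_iff_lt_or_eq.1 hv' with h | rfl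
        · exact h4 v' h
        · intro h0
          exact hb ⟨by omega, fun h => by omega⟩
      · right
        refine ⟨h3, h4, fun v' hv' h0 => ?_⟩
        rcases Nat.lt_succ_iff_lt_or_eq.1 hv' with h | rfl
        · exact h5 v' h h0
        · by_contra hc
          exact hb ⟨by omega, fun h => hc h.2⟩
  · intro m' hF hI
    rcases hI with ⟨h1, h2⟩ | h
    · obtain ⟨v, hv, h3⟩ := hex
      exact absurd h3 (h2 v hv)
    · exact h

theorem wp_relaxArc {r u v q : ℕ} {P : ℕ → ℕ → Prop} {w : RExp} (hr : r ≠ 0)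
    (hC : Cheapest a k j σ W φ ρ) (hu : m.nat 13 0 0 = u) (hv15 : m.nat 15 0 0 = v)
    (hq16 : m.nat 16 0 0 = q) (hv : v < k) (hq : q < j) (harc : Arc a σ φ u v q)
    (hw : w.eval m = arcWeight a σ W u v q) (hD : DijkstraIn a k j σ φ W ρ r P m) :
    Wp N (relaxArc w)
      (DijkstraIn a k j σ φ W ρ r fun q' v' => P q' v' ∨ (q' = q ∧ v' = v)) m := by
  unfold DijkstraIn at hD ⊢
  rw [hu] at hD
  refine wp_ite (fun hb => wp_skip ?_) fun hb => ?_
  · simp only [BExp.holds, RExp.eval, NExp.eval, hu, hv15, hw] at hb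
    rw [hu]
    exact hD.skip fun _ => hb
  · simp only [BExp.holds, RExp.eval, NExp.eval, hu, hv15, hw] at hb
    refine wp_seq (wp_setReal (wp_seq (wp_setNat (wp_seq (wp_setNat (wp_setNat ?_))))))
    simpa [hu, hv15, hq16, hw] using
      hD.relax hr hC (c := 1) one_ne_zero hv hq harc (lt_of_not_ge hb)

theorem wp_relaxAll {r : ℕ} (hE : Inserting k j a σ φ W ρ m) (hN : k ≤ N) (hj : j ≤ N)
    (hr : r ≠ 0) (hC : Cheapest a k j σ W φ ρ)
    (hD : DijkstraIn a k j σ φ W ρ r (fun _ _ => False) m) :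
    Wp N relaxAll (DijkstraIn a k j σ φ W ρ r fun _ _ => True) m := by
  refine wp_forLoop (B := j) (fun i m' => DijkstraIn a k j σ φ W ρ r (fun q v => q < i) m')
    (by omega) rfl ?_ ?_ ?_ ?_
  · intro m' hF
    simp [(hE.of_frame hF rfl).point]
  · simp only [DijkstraIn] at hD ⊢
    simpa using hD
  · intro q m1 hq hF hv hI
    have hE1 := hE.of_frame hF rfl
    refine wp_forLoop (B := k) (fun i m' => DijkstraIn a k j σ φ W ρ r
      (fun q' v => q' < q ∨ (q' = q ∧ v < i)) m') (by omega) rfl ?_ ?_ ?_ ?_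
    · intro m' hF'
      simp [(hE1.of_frame hF' rfl).centers]
    · simp only [DijkstraIn] at hI ⊢
      simpa using hI
    · intro v m2 hv' hF' hv2 hI2
      have hE2 := hE1.of_frame hF' rfl
      have hq2 : m2.nat 16 0 0 = q := by rw [hF'.1 16 rfl, hv]
      have goal : ∀ m3, DijkstraIn a k j σ φ W ρ r
          (fun q' v' => (q' < q ∨ (q' = q ∧ v' < v)) ∨ (q' = q ∧ v' = v)) m3 →
          DijkstraIn a k j σ φ W ρ r (fun q' v' => q' < q ∨ (q' = q ∧ v' < v + 1))
            (m3.putNat 15 0 0 (v + 1)) := by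
        intro m3 h3
        simp only [DijkstraIn] at h3 ⊢
        simpa using h3.congr (by intros; omega)
      -- a pair `(q, v)` that is no arc counts as relaxed
      have noarc : ¬ Arc a σ φ (m2.nat 13 0 0) v q → DijkstraIn a k j σ φ W ρ r
          (fun q' v' => q' < q ∨ (q' = q ∧ v' < v + 1)) (m2.putNat 15 0 0 (v + 1)) :=
        fun h => goal m2 (hI2.skip fun h' => absurd h' h)
      refine wp_ite (fun hb => ?_) fun hb => ?_ <;>
      simp only [BExp.holds, NExp.eval, hq2, hE2.attrs q hq, hE2.attr, ← le_antisymm_iff] at hb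
      · refine wp_ite (fun hb' => ?_) fun hb' => wp_skip ?_ <;>
        simp only [BExp.holds, NExp.eval, hq2, hE2.assignment, ← le_antisymm_iff] at hb'
        · refine (wp_relaxArc hr hC rfl hv2 hq2 hv' hq (Or.inl ⟨hb, hb'⟩) ?_ hI2).mono
            fun m3 _ h3 => goal m3 h3
          simp [arcWeight, hb, hE2.weights, hq2, hv2]
        · refine noarc ?_
          rintro (⟨-, h⟩ | ⟨h, -⟩)
          · exact hb' h
          · exact h hb
      · refine wp_ite (fun hb' => ?_) fun hb' => wp_skip ?_ <;>
        simp only [BExp.holds, NExp.eval, hq2, hv2, hE2.assignment, ← le_antisymm_iff] at hb'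
        · refine (wp_relaxArc hr hC rfl hv2 hq2 hv' hq (Or.inr ⟨hb, hb'⟩) ?_ hI2).mono
            fun m3 _ h3 => goal m3 h3
          simp [arcWeight, hb, hE2.weights, hq2, hv2]
        · refine noarc ?_
          rintro (⟨h, -⟩ | ⟨-, h⟩)
          · exact hb h
          · exact hb' h
    · intro m' hF' hI'
      simp only [DijkstraIn] at hI' ⊢
      simpa using hI'.congr (P' := fun q' _ => q' < q + 1) (by intros; omega)
  · intro m' hF hI
    exact hI.congr (fun q hq _ _ _ => hq)

theorem wp_shortestPaths (hE : Inserting k j a σ φ W ρ m) (hN : k ≤ N) (hj : j ≤ N)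
    (hC : Cheapest a k j σ W φ ρ) :
    Wp N shortestPaths (DijkstraIn a k j σ φ W ρ k fun _ _ => True) m := by
  refine wp_seq (wp_forLoop (B := k) (fun i m' => ∀ v < i, m'.real 4 0 v = W j v ∧
    m'.nat 9 0 v = 0 ∧ m'.nat 10 0 v = 0) (by omega) rfl ?_ ?_ ?_ ?_)
  · intro m' hF
    simp [(hE.of_frame hF rfl).centers]
  · simp
  · intro v m1 hv hF hv1 hI
    have hE1 := hE.of_frame hF rfl
    refine wp_seq (wp_setReal (wp_seq (wp_setNat (wp_setNat ?_))))
    intro v' hv'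
    by_cases h : v' = v
    · subst h
      simp [hv1, hE1.point, hE1.weights]
    · simpa [hv1, h] using hI v' (by omega)
  · intro m1 hF1 hI1
    have hE1 := hE.of_frame hF1 rfl
    refine wp_forLoop (B := k) (fun i m' => DijkstraIn a k j σ φ W ρ i (fun _ _ => True) m')
      (by omega) rfl ?_ ?_ ?_ ?_
    · intro m' hF
      simp [(hE1.of_frame hF rfl).centers]
    · simp only [DijkstraIn]
      refine dijkstra_init ?_ ?_ ?_ _ _ <;> intro v hv <;> simp [hI1 v hv]
    · intro r m2 hr hF2 hr2 hI2
      have hE2 := hE1.of_frame hF2 rfl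
      refine wp_seq ((wp_selectNext hE2 hN (hI2.exists_unvisited hr)).mono ?_)
      rintro m3 hF3 ⟨hu, hu0, hmin⟩
      have hr3 : m3.nat 14 0 0 = r := by rw [hF3.1 14 rfl, hr2]
      have hE3 := hE2.of_frame hF3 rfl
      refine wp_seq (wp_setNat ?_)
      have hvis := hI2.visit hu hu0 hmin
      have hD : DijkstraIn a k j σ φ W ρ (r + 1) (fun _ _ => False)
          (m3.putNat 9 0 (m3.nat 13 0 0) (r + 1)) := by
        simp only [DijkstraIn]
        simpa [hF3.1 9 rfl, hF3.1 10 rfl, hF3.1 11 rfl, hF3.1 12 rfl, hF3.2 4 rfl] using hvis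
      have hE4 : Inserting k j a σ φ W ρ (m3.putNat 9 0 (m3.nat 13 0 0) (r + 1)) :=
        ⟨by simp [hE3.centers], by simp [hE3.point], by simp [hE3.attr],
          by simpa using hE3.attrs, by simp [hE3.assignment], by simp [hE3.weights],
          by simp [hE3.prices]⟩
      simp only [NExp.eval, hr3]
      refine (wp_relaxAll hE4 hN hj (Nat.succ_ne_zero r) hC hD).mono fun m' _ h => ?_
      simp only [DijkstraIn] at h ⊢
      simpa using h
    · intro m' _ h
      exact h

theorem wp_chooseEnd {f : ℕ} {M : ℝ} (hE : Inserting k j a σ φ W ρ m) (hN : k ≤ N) (hk : 0 < k)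
    (hf : m.nat 5 0 0 = f) (hM : m.real 2 0 0 = M)
    (hb : ∀ v < k, (m.nat 8 a v : ℤ) - m.nat 8 (1 - a) v = bal a σ φ j v) :
    Wp N chooseEnd (fun m' => m'.nat 17 0 0 < k ∧
      m'.real 5 0 (m'.nat 17 0 0) =
        m.real 4 0 (m'.nat 17 0 0) + slope f M (bal a σ φ j (m'.nat 17 0 0)) ∧
      ∀ v < k, m'.real 5 0 (m'.nat 17 0 0) ≤ m.real 4 0 v + slope f M (bal a σ φ j v)) m := by
  refine wp_seq (wp_setNat ?_)
  refine wp_forLoop (B := k) (fun i m' =>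
    (∀ v < i, m'.real 5 0 v = m.real 4 0 v + slope f M (bal a σ φ j v)) ∧
    ((i = 0 ∧ m'.nat 17 0 0 = k) ∨ (m'.nat 17 0 0 < i ∧
      ∀ v < i, m'.real 5 0 (m'.nat 17 0 0) ≤ m'.real 5 0 v))) (by omega) rfl ?_ ?_ ?_ ?_
  · intro m' hF
    simp [hF.1 0 rfl, hE.centers]
  · simp [hE.centers]
  · rintro v m1 hv hF hv1 ⟨hI, hI'⟩
    have e0 : m1.nat 0 1 0 = k := by rw [hF.1 0 rfl]; simp [hE.centers]
    have e7 : m1.nat 7 0 0 = a := by rw [hF.1 7 rfl]; simp [hE.attr]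
    have e8 : m1.nat 8 = m.nat 8 := by rw [hF.1 8 rfl]; simp
    have e5 : m1.nat 5 0 0 = f := by rw [hF.1 5 rfl]; simp [hf]
    have e4 : m1.real 4 = m.real 4 := by rw [hF.2 4 rfl]; simp
    have e2 : m1.real 2 0 0 = M := by rw [hF.2 2 rfl]; simp [hM]
    refine wp_seq ?_
    -- whichever branch computes the entry `x` of array `5`, the second test is the same
    have hstep : ∀ x, x = m.real 4 0 v + slope f M (bal a σ φ j v) →
        Wp N (.ite (.and (.natLe (.add (var 17) (.const 1)) kN)
          (.realLe (rowR 5 (var 17)) (rowR 5 (var 15)))) .skip (setVar 17 (var 15)))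
        (fun m' => (∀ v' < v + 1, (m'.putNat 15 0 0 (v + 1)).real 5 0 v' =
            m.real 4 0 v' + slope f M (bal a σ φ j v')) ∧
          ((v + 1 = 0 ∧ (m'.putNat 15 0 0 (v + 1)).nat 17 0 0 = k) ∨
          ((m'.putNat 15 0 0 (v + 1)).nat 17 0 0 < v + 1 ∧
            ∀ v' < v + 1, (m'.putNat 15 0 0 (v + 1)).real 5 0
              ((m'.putNat 15 0 0 (v + 1)).nat 17 0 0) ≤ (m'.putNat 15 0 0 (v + 1)).real 5 0 v')))
        (m1.putReal 5 0 v x) := by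
      intro x hx
      have hH : ∀ v' < v + 1, Function.update (m1.real 5 0) v x v' =
          m.real 4 0 v' + slope f M (bal a σ φ j v') := by
        intro v' hv'
        by_cases h : v' = v
        · rw [h, Function.update_self, hx]
        · rw [Function.update_of_ne h]
          exact hI v' (by omega)
      refine wp_ite (fun hc => wp_skip ?_) fun hc => wp_setNat ?_
      · simp only [BExp.holds, NExp.eval, RExp.eval, State.putReal_nat, e0, hv1,
          State.putReal_row, Function.update_self] at hc
        simp only [State.putNat_real, State.putReal_row, State.putReal_nat,
          State.putNat_nat_ne _ _ _ _ (show 17 ≠ 15 by decide)]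
        refine ⟨hH, Or.inr ?_⟩
        rcases hI' with ⟨rfl, h2⟩ | ⟨h2, h3⟩
        · omega
        · refine ⟨by omega, fun v' hv' => ?_⟩
          by_cases h : v' = v
          · rw [h, Function.update_self]
            exact hc.2
          · rw [Function.update_of_ne h, Function.update_of_ne h2.ne]
            exact h3 v' (by omega)
      · simp only [BExp.holds, NExp.eval, RExp.eval, State.putReal_nat, e0, hv1,
          State.putReal_row, Function.update_self] at hc
        simp only [NExp.eval, State.putNat_real, State.putReal_row, State.putReal_nat, hv1,
          State.putNat_nat_ne _ _ _ _ (show 17 ≠ 15 by decide), State.putNat_row,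
          Function.update_self]
        refine ⟨hH, Or.inr ⟨by omega, fun v' hv' => ?_⟩⟩
        by_cases h : v' = v
        · rw [h, Function.update_self]
        · rcases hI' with ⟨rfl, h2⟩ | ⟨h2, h3⟩
          · omega
          · rw [Function.update_of_ne h2.ne] at hc
            rw [Function.update_of_ne h]
            have h4 : ¬ _ ≤ _ := fun h => hc ⟨by omega, h⟩
            have := h3 v' (by omega)
            linarith
    have hbv := hb v hv
    refine wp_ite (fun hc => ?_) fun hc => wp_ite (fun hc' => ?_) fun hc' => ?_
    · simp only [BExp.holds, NExp.eval, e7, e8, e5, hv1] at hc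
      refine wp_setReal ?_
      simp only [NExp.eval, RExp.eval, hv1, e4, e2]
      refine hstep _ ?_
      rw [slope, if_pos (by omega)]
    · simp only [BExp.holds, NExp.eval, e7, e8, e5, hv1] at hc hc'
      refine wp_setReal ?_
      simp only [NExp.eval, RExp.eval, hv1, e4, e2]
      refine hstep _ ?_
      rw [slope, if_neg (by omega), if_pos (by omega)]
      ring
    · simp only [BExp.holds, NExp.eval, e7, e8, e5, hv1] at hc hc'
      refine wp_setReal ?_
      simp only [NExp.eval, RExp.eval, hv1, e4]
      refine hstep _ ?_
      rw [slope, if_neg (by omega), if_neg (by omega), add_zero]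
  · rintro m' - ⟨h1, h2⟩
    rcases h2 with ⟨h2, -⟩ | ⟨h2, h3⟩
    · omega
    · exact ⟨h2, h1 _ h2, fun v hv => (h3 v hv).trans (h1 v hv).le⟩

theorem wp_updatePrices {D : ℕ → ℝ} {e : ℕ} {H : ℝ} (hk : m.nat 0 1 0 = k) (ha2 : a < 2)
    (ha : m.nat 7 0 0 = a) (hρ : m.real 3 a = ρ)
    (hD : m.real 4 0 = D) (he : m.nat 17 0 0 = e) (hH : m.real 5 0 e = H) (hN : k ≤ N) :
    Wp N updatePrices (fun m' =>
      (∀ v < k, m'.real 3 a v = max (ρ v) (H - D v) ∧ m'.real 3 (1 - a) v = -max (ρ v) (H - D v)) ∧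
      m'.nat 8 a = Function.update (m.nat 8 a) e (m.nat 8 a e + 1) ∧
      m'.nat 8 (1 - a) = m.nat 8 (1 - a)) m := by
  have hne : a ≠ 1 - a := by omega
  refine wp_seq (wp_forLoop (B := k) (fun i m' =>
    (∀ v < i, m'.real 3 a v = max (ρ v) (H - D v) ∧ m'.real 3 (1 - a) v = -max (ρ v) (H - D v)) ∧
    (∀ v, i ≤ v → m'.real 3 a v = ρ v)) (by omega) rfl ?_ ?_ ?_ ?_)
  · intro m' hF
    simp [hF.1 0 rfl, hk]
  · simp [hρ]
  · rintro v m1 hv hF hv1 ⟨hI, hI'⟩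
    have e7 : m1.nat 7 0 0 = a := by rw [hF.1 7 rfl]; simp [ha]
    have e17 : m1.nat 17 0 0 = e := by rw [hF.1 17 rfl]; simp [he]
    have e4 : m1.real 4 0 = D := by rw [hF.2 4 rfl]; simp [hD]
    have e5 : m1.real 5 0 e = H := by rw [hF.2 5 rfl]; simp [hH]
    have hIv := hI' v le_rfl
    refine wp_seq (wp_ite (fun hc => wp_setReal (wp_setReal ?_)) fun hc => wp_skip (wp_setReal ?_))
    · simp only [BExp.holds, NExp.eval, RExp.eval, e7, e17, e4, e5, hv1, hIv] at hc
      simp only [NExp.eval, RExp.eval, State.putReal_nat, State.putNat_real, e7, e17, e4, e5, hv1,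
        State.putReal_row, State.putReal_row_ne _ _ _ _ hne, State.putReal_row_ne _ _ _ _ hne.symm,
        Function.update_self]
      refine ⟨fun v' hv' => ?_, fun v' hv' => ?_⟩
      · by_cases h : v' = v
        · rw [h, Function.update_self, Function.update_self, max_eq_right hc]
          simp
        · rw [Function.update_of_ne h, Function.update_of_ne h]
          exact hI v' (by omega)
      · rw [Function.update_of_ne (by omega)]
        exact hI' v' (by omega)
    · simp only [BExp.holds, NExp.eval, RExp.eval, e7, e17, e4, e5, hv1, hIv] at hc
      simp only [NExp.eval, RExp.eval, State.putNat_real, e7, hv1,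
        State.putReal_row, State.putReal_row_ne _ _ _ _ hne]
      refine ⟨fun v' hv' => ?_, fun v' hv' => hI' v' (by omega)⟩
      by_cases h : v' = v
      · rw [h, Function.update_self, hIv, max_eq_left (by linarith)]
        simp
      · rw [Function.update_of_ne h]
        exact hI v' (by omega)
  · rintro m' hF ⟨hI, -⟩
    refine wp_setNat ?_
    have e7 : m'.nat 7 0 0 = a := by rw [hF.1 7 rfl, ha]
    have e17 : m'.nat 17 0 0 = e := by rw [hF.1 17 rfl, he]
    have e8 := hF.1 8 rfl
    simp only [NExp.eval, State.putNat_real, e7, e17, e8, State.putNat_row,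
      State.putNat_row_ne _ _ _ _ hne.symm]
    exact ⟨hI, trivial, trivial⟩

theorem wp_augment {f e : ℕ} {M H : ℝ} (hE : Inserting k j a σ φ W ρ m) (hN : k ≤ N)
    (he : m.nat 17 0 0 = e) (hek : e < k)
    (hC : Certificate a k j σ W f M φ ρ) (hM : 0 ≤ M) (hj : σ j = a)
    (hD : DijkstraIn a k j σ φ W ρ k (fun _ _ => True) m)
    (hH : H = m.real 4 0 e + slope f M (bal a σ φ j e))
    (hmin : ∀ v < k, H ≤ m.real 4 0 v + slope f M (bal a σ φ j v)) :
    Wp N augment (fun m' => Certificate a k (j + 1) σ W f M (m'.nat 4 0)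
      (fun v => max (ρ v) (H - m.real 4 0 v)) ∧
      ∀ v, bal a σ (m'.nat 4 0) (j + 1) v = bal a σ φ j v + if v = e then 1 else 0) m := by
  refine wp_seq (wp_setNat (wp_seq ?_))
  refine wp_forLoop (B := k) (fun i m' => Augmenting a k j σ φ W ρ (m.real 4 0) (m.nat 9 0)
    (m.nat 10 0) (m.nat 11 0) (m.nat 12 0) H e (k - i) (m'.nat 19 0 0) (m'.nat 4 0))
    (by omega) rfl ?_ ?_ ?_ ?_
  · intro m' hF
    simp [hF.1 0 rfl, hE.centers]
  · simpa [he, hE.assignment] using augmenting_init hC hD hek hH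
  · intro t m1 ht hF ht1 hI
    have e7 : m1.nat 7 0 0 = a := by rw [hF.1 7 rfl]; simp [hE.attr]
    have e1 : m1.nat 1 = m.nat 1 := by rw [hF.1 1 rfl]; simp
    have e10 : m1.nat 10 0 = m.nat 10 0 := by rw [hF.1 10 rfl]; simp
    have e11 : m1.nat 11 0 = m.nat 11 0 := by rw [hF.1 11 rfl]; simp
    have e12 : m1.nat 12 0 = m.nat 12 0 := by rw [hF.1 12 rfl]; simp
    have hs : k - t = k - (t + 1) + 1 := by omega
    refine wp_ite (fun hb => ?_) fun hb => wp_skip ?_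
    · simp only [BExp.holds, NExp.eval, e10] at hb
      have hx : m.nat 10 0 (m1.nat 19 0 0) ≠ 0 := by omega
      rw [hs] at hI
      have hstep := hI.step hC hD hx
      have hpp := (hD.pred _ hI.lt hx).2.1
      refine wp_seq (wp_ite (fun hc => wp_setNat (wp_setNat ?_)) fun hc => wp_setNat (wp_setNat ?_))
      · simp only [BExp.holds, NExp.eval, e12, e1, e7, hE.attrs _ hpp, ← le_antisymm_iff] at hc
        rw [if_pos hc] at hstep
        simpa [e10, e11, e12] using hstep
      · simp only [BExp.holds, NExp.eval, e12, e1, e7, hE.attrs _ hpp, ← le_antisymm_iff] at hc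
        rw [if_neg hc] at hstep
        simpa [e10, e11, e12] using hstep
    · simp only [BExp.holds, NExp.eval, e10] at hb
      simpa using { hI with rank_le := Or.inl (by omega) }
  · intro m' hF hI
    rw [Nat.sub_self] at hI
    refine wp_setNat ?_
    have e6 : m'.nat 6 0 0 = j := by rw [hF.1 6 rfl]; simp [hE.point]
    simp only [NExp.eval, e6, State.putNat_row]
    refine ⟨hI.finish hM hC hD hek hH hmin hj, fun v => ?_⟩
    rw [bal_succ, ← hI.bal_eq v]
    simp [sgn, hj, eq_comm]

/-- The state of the computation after the first `j` points have been inserted: rows `0` and `1` of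
the prices and of the imbalances are negatives of each other, so that the next point can be inserted
relative to its own attribute. -/
structure Assigned (k j : ℕ) (σ : ℕ → ℕ) (W : ℕ → ℕ → ℝ) (f : ℕ) (M : ℝ) (m : State) : Prop where
  certificate : ∀ a < 2, Certificate a k j σ W f M (m.nat 4 0) (m.real 3 a)
  bal_eq : ∀ a < 2, ∀ v < k, (m.nat 8 a v : ℤ) - m.nat 8 (1 - a) v = bal a σ (m.nat 4 0) j v
  neg : ∀ a < 2, ∀ v < k, m.real 3 (1 - a) v = -m.real 3 a v

theorem Certificate.congr {f : ℕ} {M : ℝ} {ρ' : ℕ → ℝ} (h : Certificate a k j σ W f M φ ρ)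
    (hρ : ∀ v < k, ρ' v = ρ v) : Certificate a k j σ W f M φ ρ' := by
  refine ⟨fun q hq => ?_, fun v hv => ?_, fun v hv => ?_⟩
  · obtain ⟨h1, h2⟩ := h.cheapest q hq
    refine ⟨h1, fun i hi => ?_⟩
    rw [hρ _ h1, hρ _ hi]
    exact h2 i hi
  · rw [hρ v hv]; exact h.slope_le v hv
  · rw [hρ v hv]; exact h.le_slope v hv

theorem wp_insertPoint {f : ℕ} {M : ℝ} (hk : m.nat 0 1 0 = k) (hk0 : 0 < k)
    (hj : m.nat 6 0 0 = j) (hσ : ∀ q ≤ j, m.nat 1 q 0 = σ q) (hσ2 : ∀ q ≤ j, σ q < 2)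
    (hW : m.real 1 = W) (hf : m.nat 5 0 0 = f) (hM : m.real 2 0 0 = M) (hM0 : 0 ≤ M)
    (hN : k ≤ N) (hjN : j ≤ N) (hA : Assigned k j σ W f M m) :
    Wp N insertPoint (Assigned k (j + 1) σ W f M) m := by
  obtain ⟨a, ha⟩ : ∃ a, σ j = a := ⟨_, rfl⟩
  have ha2 : a < 2 := ha ▸ hσ2 j le_rfl
  refine wp_seq (wp_setNat ?_)
  simp only [NExp.eval, hj, hσ j le_rfl, ha]
  have hE : Inserting k j a σ (m.nat 4 0) W (m.real 3 a) (m.putNat 7 0 0 a) :=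
    ⟨by simp [hk], by simp [hj], by simp, fun q hq => by simp [hσ q hq.le], by simp, by simp [hW],
      by simp⟩
  have hC := hA.certificate a ha2
  refine wp_seq ((wp_shortestPaths hE hN hjN hC.cheapest).mono fun m1 hF1 hD => wp_seq ?_)
  have hE1 := hE.of_frame hF1 rfl
  have e18 : m1.nat 8 = m.nat 8 := by rw [hF1.1 8 rfl]; simp
  refine (wp_chooseEnd (f := f) (M := M) hE1 hN hk0 (by rw [hF1.1 5 rfl]; simp [hf])
    (by rw [hF1.2 2 rfl]; simp [hM]) (by rw [e18]; exact hA.bal_eq a ha2)).mono ?_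
  rintro m2 hF2 ⟨hek, hH, hmin⟩
  have hE2 := hE1.of_frame hF2 rfl
  have e24 : m2.real 4 = m1.real 4 := hF2.2 4 rfl
  rw [← e24] at hH hmin
  have hD2 : DijkstraIn a k j σ (m.nat 4 0) W (m.real 3 a) k (fun _ _ => True) m2 := by
    simpa only [DijkstraIn, e24, hF2.1 9 rfl, hF2.1 10 rfl, hF2.1 11 rfl, hF2.1 12 rfl,
      hF2.1 13 rfl] using hD
  refine wp_seq ((wp_augment hE2 hN rfl hek hC hM0 ha hD2 hH hmin).mono ?_)
  rintro m3 hF3 ⟨hC3, hb3⟩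
  have e38 : m3.nat 8 = m.nat 8 := by rw [hF3.1 8 rfl, hF2.1 8 rfl, e18]
  refine (wp_updatePrices (D := m2.real 4 0) (e := m2.nat 17 0 0)
    (H := m2.real 5 0 (m2.nat 17 0 0)) (ρ := m.real 3 a) (by rw [hF3.1 0 rfl]; exact hE2.centers)
    ha2 (by rw [hF3.1 7 rfl]; exact hE2.attr) (by rw [hF3.2 3 rfl]; exact hE2.prices)
    (by rw [hF3.2 4 rfl]) (by rw [hF3.1 17 rfl]) (by rw [hF3.2 5 rfl]) hN).mono ?_
  rintro m4 hF4 ⟨hρ4, hu4, hn4⟩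
  rw [e38] at hu4 hn4
  have e44 : m4.nat 4 = m3.nat 4 := hF4.1 4 rfl
  have hσ2' : ∀ q < j + 1, σ q < 2 := fun q hq => hσ2 q (by omega)
  have hCa : Certificate a k (j + 1) σ W f M (m4.nat 4 0) (m4.real 3 a) := by
    rw [e44]
    exact hC3.congr fun v hv => (hρ4 v hv).1
  have hba : ∀ v < k, (m4.nat 8 a v : ℤ) - m4.nat 8 (1 - a) v =
      bal a σ (m4.nat 4 0) (j + 1) v := by
    intro v hv
    rw [e44, hb3, ← hA.bal_eq a ha2 v hv, hu4, hn4]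
    by_cases h : v = m2.nat 17 0 0
    · rw [← h, Function.update_self, if_pos rfl]
      push_cast
      ring
    · rw [Function.update_of_ne h, if_neg h, add_zero]
  have hna : ∀ v < k, m4.real 3 (1 - a) v = -m4.real 3 a v := fun v hv => by
    rw [(hρ4 v hv).1, (hρ4 v hv).2]
  have hinv : 1 - (1 - a) = a := by omega
  have hcase : ∀ c < 2, c = a ∨ c = 1 - a := fun c hc => by omega
  refine ⟨fun c hc => ?_, fun c hc => ?_, fun c hc => ?_⟩ <;> rcases hcase c hc with rfl | rfl
  · exact hCa
  · exact hCa.swap hσ2' ha2 hna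
  · exact hba
  · intro v hv
    rw [bal_swap hσ2' ha2, ← hba v hv, hinv]
    ring
  · exact hna
  · intro v hv
    rw [hinv, hna v hv, neg_neg]

end Insertion

/-! ### One round of the program -/

section Round

attribute [local simp] State.putNat_nat_ne State.putReal_real_ne NExp.eval RExp.eval BExp.holds

/-- The maximum (if `b` is positive) or the sum of the contributions of the first `n` points. -/
noncomputable def objective (b : ℕ) (d : ℕ → ℕ → ℝ) (φ : ℕ → ℕ) : ℕ → ℝ
  | 0 => 0
  | n + 1 => if 1 ≤ b then max (objective b d φ n) (d n (φ n)) else objective b d φ n + d n (φ n)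

variable {N n k : ℕ} {σ : ℕ → ℕ} {W : ℕ → ℕ → ℝ} {f : ℕ} {M : ℝ} {m : State}

theorem wp_assign (hn : m.nat 0 0 0 = n) (hk : m.nat 0 1 0 = k) (hk0 : 0 < k ∨ n = 0)
    (hσ : ∀ q < n, m.nat 1 q 0 = σ q) (hσ2 : ∀ q < n, σ q < 2) (hW : m.real 1 = W)
    (hf : m.nat 5 0 0 = f) (hM : m.real 2 0 0 = M) (hM0 : 0 ≤ M) (hN : n + k ≤ N) :
    Wp N assign (Assigned k n σ W f M) m := by
  refine wp_seq (wp_forLoop (B := k) (fun i m' => ∀ v < i, ∀ c < 2, m'.nat 8 c v = 0 ∧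
    m'.real 3 c v = 0) (by omega) rfl ?_ ?_ ?_ ?_)
  · intro m' hF
    simp [hF.1 0 rfl, hk]
  · simp
  · intro v m1 hv hF hv1 hI
    refine wp_seq (wp_setNat (wp_seq (wp_setNat (wp_seq (wp_setReal (wp_setReal ?_))))))
    intro v' hv' c hc
    have hc' : c = 0 ∨ c = 1 := by omega
    by_cases h : v' = v
    · subst h
      rcases hc' with rfl | rfl <;> simp [hv1, State.putNat_row_ne, State.putReal_row_ne]
    · have := hI v' (by omega) c hc
      rcases hc' with rfl | rfl <;>
        simpa [hv1, h, State.putNat_row_ne, State.putReal_row_ne] using this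
  · intro m1 hF1 hI1
    refine wp_forLoop (B := n) (fun i m' => Assigned k i σ W f M m') (by omega) rfl ?_ ?_ ?_ ?_
    · intro m' hF
      simp [hF.1 0 rfl, hF1.1 0 rfl, hn]
    · refine ⟨fun a ha => ⟨fun q hq => absurd hq (Nat.not_lt_zero q), fun v hv => ?_,
        fun v hv => ?_⟩, fun a ha v hv => ?_, fun a ha v hv => ?_⟩
      · have := (hI1 v hv a ha).2
        simp only [State.putNat_real, this, bal, Finset.range_zero, Finset.sum_empty]
        exact slope_neg_one_le hM0
      · have := (hI1 v hv a ha).2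
        simp only [State.putNat_real, this, bal, Finset.range_zero, Finset.sum_empty]
        exact slope_zero_nonneg hM0
      · simp [hI1 v hv a ha, hI1 v hv (1 - a) (by omega), bal]
      · simp [hI1 v hv a ha, hI1 v hv (1 - a) (by omega)]
    · intro j m2 hj hF2 hj2 hI2
      refine (wp_insertPoint (k := k) (j := j) (σ := σ) (W := W) (f := f) (M := M)
        (by rw [hF2.1 0 rfl, hF1.1 0 rfl, hk]) (by omega) hj2
        (fun q hq => by rw [hF2.1 1 rfl, hF1.1 1 rfl]; exact hσ q (by omega))
        (fun q hq => hσ2 q (by omega)) (by rw [hF2.2 1 rfl, hF1.2 1 rfl, hW])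
        (by rw [hF2.1 5 rfl, hF1.1 5 rfl, hf]) (by rw [hF2.2 2 rfl, hF1.2 2 rfl, hM]) hM0
        (by omega) (by omega) hI2).mono fun m3 _ h => ?_
      obtain ⟨h1, h2, h3⟩ := h
      exact ⟨by simpa using h1, by simpa using h2, by simpa using h3⟩
    · intro m' _ h
      exact h

theorem wp_checkBound {β : ℕ → ℤ} (hk : m.nat 0 1 0 = k) (hf : m.nat 5 0 0 = f) (hN : k ≤ N)
    (hb : ∀ v < k, (m.nat 8 0 v : ℤ) - m.nat 8 1 v = β v) :
    Wp N checkBound (fun m' => 1 ≤ m'.nat 20 0 0 ↔ ∀ v < k, |β v| ≤ f) m := by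
  refine wp_seq (wp_setNat ?_)
  refine wp_forLoop (B := k) (fun i m' => 1 ≤ m'.nat 20 0 0 ↔ ∀ v < i, |β v| ≤ f)
    (by omega) rfl ?_ ?_ ?_ ?_
  · intro m' hF
    simp [hF.1 0 rfl, hk]
  · simp
  · intro v m1 hv hF hv1 hI
    have e8 : m1.nat 8 = m.nat 8 := by rw [hF.1 8 rfl]; simp
    have e5 : m1.nat 5 0 0 = f := by rw [hF.1 5 rfl]; simp [hf]
    have hbv := hb v hv
    refine wp_ite (fun hc => wp_skip ?_) fun hc => wp_setNat ?_
    · simp only [BExp.holds, NExp.eval, e8, e5, hv1] at hc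
      have : |β v| ≤ f := abs_le.2 ⟨by omega, by omega⟩
      simp only [State.putNat_nat_ne _ _ _ _ (show 20 ≠ 15 by decide), hI]
      exact ⟨fun h v' hv' => (Nat.lt_succ_iff_lt_or_eq.1 hv').elim (h v') (fun e => e ▸ this),
        fun h v' hv' => h v' (by omega)⟩
    · simp only [BExp.holds, NExp.eval, e8, e5, hv1] at hc
      simp only [NExp.eval, State.putNat_nat_ne _ _ _ _ (show 20 ≠ 15 by decide),
        State.putNat_row, Function.update_self]
      refine ⟨fun h => absurd h (by omega),
        fun h => absurd (abs_le.1 (h v (Nat.lt_succ_self v))) ?_⟩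
      rintro ⟨h1, h2⟩
      exact hc ⟨by omega, by omega⟩
  · intro m' _ h
    exact h

theorem wp_computeKey (hn : m.nat 0 0 0 = n) (hN : n ≤ N) :
    Wp N computeKey (fun m' => m'.real 6 0 0 =
      objective (m.nat 0 2 0) (m.real 0) (m.nat 4 0) n) m := by
  refine wp_seq (wp_setReal ?_)
  refine wp_forLoop (B := n) (fun i m' => m'.real 6 0 0 =
    objective (m.nat 0 2 0) (m.real 0) (m.nat 4 0) i) (by omega) rfl ?_ ?_ ?_ ?_
  · intro m' hF
    simp [hF.1 0 rfl, hn]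
  · simp [objective]
  · intro q m1 hq hF hq1 hI
    have e0 : m1.nat 0 = m.nat 0 := by rw [hF.1 0 rfl]; simp
    have e4 : m1.nat 4 = m.nat 4 := by rw [hF.1 4 rfl]; simp
    have r0 : m1.real 0 = m.real 0 := by rw [hF.2 0 rfl]; simp
    refine wp_ite (fun hb => wp_ite (fun hc => wp_skip ?_) fun hc => wp_setReal ?_)
      fun hb => wp_setReal ?_
    · simp only [BExp.holds, NExp.eval, RExp.eval, e0, e4, r0, hq1, hI] at hb hc
      simp [objective, hb, hI, max_eq_left hc]
    · simp only [BExp.holds, NExp.eval, RExp.eval, e0, e4, r0, hq1, hI] at hb hc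
      simp [objective, hb, e4, r0, hq1, max_eq_right (not_le.1 hc).le]
    · simp only [BExp.holds, NExp.eval, e0] at hb
      simp [objective, hb, hI, e4, r0, hq1]
  · intro m' _ h
    exact h

theorem wp_append {l : ℕ} (hn : m.nat 0 0 0 = n) (hl : m.nat 2 0 0 = l) (hN : n ≤ N) :
    Wp N append (fun m' => m'.nat 2 0 0 = l + 1 ∧ m'.real 7 0 0 = m.real 6 0 0 ∧
      (∀ q < n, m'.nat 3 l q = m.nat 4 0 q) ∧ ∀ r, r ≠ l → m'.nat 3 r = m.nat 3 r) m := by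
  refine wp_seq (wp_forLoop (B := n) (fun i m' => (∀ q < i, m'.nat 3 l q = m.nat 4 0 q) ∧
    ∀ r, r ≠ l → m'.nat 3 r = m.nat 3 r) (by omega) rfl ?_ ?_ ?_ ?_)
  · intro m' hF
    simp [hF.1 0 rfl, hn]
  · simp
  · rintro q m1 hq hF hq1 ⟨hI, hI'⟩
    have e2 : m1.nat 2 0 0 = l := by rw [hF.1 2 rfl]; simp [hl]
    have e4 : m1.nat 4 = m.nat 4 := by rw [hF.1 4 rfl]
    refine wp_setNat ⟨fun q' hq' => ?_, fun r hr => ?_⟩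
    · by_cases h : q' = q
      · simp [h, e2, e4, hq1]
      · simpa [e2, e4, hq1, h] using hI q' (by omega)
    · simpa [e2, State.putNat_row_ne _ _ _ _ hr] using hI' r hr
  · rintro m1 hF ⟨hI, hI'⟩
    refine wp_seq (wp_setNat (wp_setReal ?_))
    have e2 : m1.nat 2 0 0 = l := by rw [hF.1 2 rfl, hl]
    simpa [e2, hF.2 6 rfl] using ⟨hI, hI'⟩

theorem wp_round {l : ℕ} (hn : m.nat 0 0 0 = n) (hk : m.nat 0 1 0 = k) (hk0 : 0 < k ∨ n = 0)
    (hσ : ∀ q < n, m.nat 1 q 0 = σ q) (hσ2 : ∀ q < n, σ q < 2) (hW : m.real 1 = W)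
    (hf : m.nat 5 0 0 = f) (hM : m.real 2 0 0 = M) (hM0 : 0 ≤ M) (hl : m.nat 2 0 0 = l)
    (hN : n + k ≤ N) :
    Wp N round (fun m' => ∃ φ ρ, Certificate 0 k n σ W f M φ ρ ∧
      let G := objective (m.nat 0 2 0) (m.real 0) φ n
      (((∀ v < k, |bal 0 σ φ n v| ≤ f) ∧ (l = 0 ∨ G < m.real 7 0 0) ∧
        m'.nat 2 0 0 = l + 1 ∧ m'.real 7 0 0 = G ∧ (∀ q < n, m'.nat 3 l q = φ q) ∧
        ∀ r, r ≠ l → m'.nat 3 r = m.nat 3 r) ∨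
      (¬ ((∀ v < k, |bal 0 σ φ n v| ≤ f) ∧ (l = 0 ∨ G < m.real 7 0 0)) ∧
        m'.nat 2 0 0 = l ∧ m'.real 7 0 0 = m.real 7 0 0 ∧ m'.nat 3 = m.nat 3))) m := by
  refine wp_seq ((wp_assign hn hk hk0 hσ hσ2 hW hf hM hM0 hN).mono fun m1 hF1 hA => ?_)
  refine wp_seq ((wp_checkBound (k := k) (f := f) (by rw [hF1.1 0 rfl, hk])
    (by rw [hF1.1 5 rfl, hf]) (by omega) (hA.bal_eq 0 (by omega))).mono fun m2 hF2 h2 => ?_)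
  refine wp_seq ((wp_computeKey (n := n) (by rw [hF2.1 0 rfl, hF1.1 0 rfl, hn])
    (by omega)).mono fun m3 hF3 h3 => ?_)
  have e4 : m3.nat 4 = m1.nat 4 := by rw [hF3.1 4 rfl, hF2.1 4 rfl]
  have e20 : m3.nat 20 = m2.nat 20 := hF3.1 20 rfl
  have e2 : m3.nat 2 0 0 = l := by rw [hF3.1 2 rfl, hF2.1 2 rfl, hF1.1 2 rfl, hl]
  have e3 : m3.nat 3 = m.nat 3 := by rw [hF3.1 3 rfl, hF2.1 3 rfl, hF1.1 3 rfl]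
  have r7 : m3.real 7 = m.real 7 := by rw [hF3.2 7 rfl, hF2.2 7 rfl, hF1.2 7 rfl]
  rw [hF2.1 0 rfl, hF1.1 0 rfl, hF2.2 0 rfl, hF1.2 0 rfl, hF2.1 4 rfl] at h3
  have hcond : (BExp.and (.natLe (.const 1) (var 20))
      (.not (.and (.natLe (.const 1) (var 2)) (.realLe (varR 7) (varR 6))))).holds m3 ↔
      (∀ v < k, |bal 0 σ (m1.nat 4 0) n v| ≤ f) ∧ (l = 0 ∨
        objective (m.nat 0 2 0) (m.real 0) (m1.nat 4 0) n < m.real 7 0 0) := by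
    simp only [BExp.holds, NExp.eval, RExp.eval, e20, e2, r7, h3, h2, not_and_or, not_le,
      Nat.lt_one_iff]
  refine wp_ite (fun hc => ?_) fun hc => wp_skip ?_
  · rw [hcond] at hc
    refine (wp_append (n := n) (by rw [hF3.1 0 rfl, hF2.1 0 rfl, hF1.1 0 rfl, hn]) e2
      (by omega)).mono ?_
    rintro m4 - ⟨h5, h6, h7, h8⟩
    refine ⟨_, _, hA.certificate 0 (by omega), Or.inl ⟨hc.1, hc.2, h5, h6.trans h3, ?_, ?_⟩⟩
    · rwa [e4] at h7
    · rwa [e3] at h8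
  · rw [hcond] at hc
    exact ⟨_, _, hA.certificate 0 (by omega), Or.inr ⟨hc, e2, by rw [r7], e3⟩⟩

end Round

/-! ### Weights and costs -/

theorem objective_congr {b : ℕ} {d : ℕ → ℕ → ℝ} {φ ψ : ℕ → ℕ} {n : ℕ} (h : ∀ q < n, φ q = ψ q) :
    objective b d φ n = objective b d ψ n := by
  induction n with
  | zero => rfl
  | succ n ih => simp only [objective, ih fun q hq => h q (by omega), h n (Nat.lt_succ_self n)]

theorem objective_eq_sum {b : ℕ} (hb : ¬ 1 ≤ b) (d : ℕ → ℕ → ℝ) (φ : ℕ → ℕ) (n : ℕ) :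
    objective b d φ n = ∑ q ∈ Finset.range n, d q (φ q) := by
  induction n with
  | zero => rfl
  | succ n ih => rw [objective, if_neg hb, ih, Finset.sum_range_succ]

theorem objective_le_iff {b : ℕ} (hb : 1 ≤ b) (d : ℕ → ℕ → ℝ) (φ : ℕ → ℕ) (n : ℕ) (c : ℝ) :
    objective b d φ n ≤ c ↔ 0 ≤ c ∧ ∀ q < n, d q (φ q) ≤ c := by
  induction n with
  | zero => simp [objective]
  | succ n ih =>
    rw [objective, if_pos hb, max_le_iff, ih, and_assoc]
    refine and_congr_right fun _ => ⟨fun h q hq => ?_, fun h => ⟨fun q hq => h q (by omega),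
      h n (Nat.lt_succ_self n)⟩⟩
    rcases Nat.lt_succ_iff_lt_or_eq.1 hq with h' | rfl
    · exact h.1 q h'
    · exact h.2

theorem below_lt {n k : ℕ} {d : ℕ → ℕ → ℝ} {q v : ℕ} {y : ℝ} (hq : q < n) (hv : v < k)
    (h : d q v < y) : below n k d (d q v) < below n k d y := by
  have hle : ∀ q' v', (if d q v ≤ d q' v' then 0 else 1) ≤ if y ≤ d q' v' then 0 else 1 := by
    intro q' v'
    split_ifs with h1 h2
    · exact le_rfl
    · exact zero_le_one
    · exact absurd (h.le.trans ‹_›) h1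
    · exact le_rfl
  refine Finset.sum_lt_sum (fun q' _ => Finset.sum_le_sum fun v' _ => hle q' v')
    ⟨q, Finset.mem_range.2 hq, ?_⟩
  refine Finset.sum_lt_sum (fun v' _ => hle q v') ⟨v, Finset.mem_range.2 hv, ?_⟩
  rw [if_pos le_rfl, if_neg (not_le.2 h)]
  exact zero_lt_one

theorem weight_nonneg {b n k : ℕ} {d : ℕ → ℕ → ℝ} (hd : ∀ q v, 0 ≤ d q v) (q v : ℕ) :
    0 ≤ weight b n k d q v := by
  unfold weight
  split_ifs
  · positivity
  · exact hd q v

/-- Minimizing the sum of the weights minimizes the objective. -/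
theorem objective_mono {b n k : ℕ} {d : ℕ → ℕ → ℝ} (hd : ∀ q v, 0 ≤ d q v) {φ ψ : ℕ → ℕ}
    (hψ : ∀ q < n, ψ q < k)
    (h : ∑ q ∈ Finset.range n, weight b n k d q (φ q) ≤
      ∑ q ∈ Finset.range n, weight b n k d q (ψ q)) :
    objective b d φ n ≤ objective b d ψ n := by
  by_cases hb : 1 ≤ b
  · obtain ⟨h0, hle⟩ := (objective_le_iff hb d ψ n _).1 le_rfl
    by_contra hc
    rw [objective_le_iff hb] at hc
    push Not at hc
    obtain ⟨q₀, hq₀, hlt⟩ := hc h0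
    -- the weight of `q₀` under `φ` alone exceeds the total weight of `ψ`
    set r := below n k d (d q₀ (φ q₀)) with hr
    have hr1 : ∀ q < n, below n k d (d q (ψ q)) + 1 ≤ r := fun q hq =>
      below_lt hq (hψ q hq) ((hle q hq).trans_lt hlt)
    have h1 : ∑ q ∈ Finset.range n, weight b n k d q (ψ q) ≤ n * 2 ^ (n * (r - 1)) := by
      rw [← nsmul_eq_mul]
      refine (Finset.sum_le_card_nsmul _ _ _ fun q hq => ?_).trans_eq (by rw [Finset.card_range])
      rw [weight, if_pos hb]
      have := hr1 q (Finset.mem_range.1 hq)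
      exact pow_le_pow_right₀ one_le_two (Nat.mul_le_mul_left n (by omega))
    have h2 : weight b n k d q₀ (φ q₀) ≤ ∑ q ∈ Finset.range n, weight b n k d q (φ q) :=
      Finset.single_le_sum (f := fun q => weight b n k d q (φ q))
        (fun q _ => weight_nonneg hd q _) (Finset.mem_range.2 hq₀)
    rw [weight, if_pos hb, ← hr] at h2
    have h3 : (n : ℝ) * 2 ^ (n * (r - 1)) < 2 ^ (n * r) := by
      have hr0 := hr1 q₀ hq₀
      rw [show n * r = n + n * (r - 1) by
        obtain ⟨s, hs⟩ : ∃ s, r = s + 1 := ⟨r - 1, by omega⟩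
        rw [hs, Nat.add_sub_cancel]; ring, pow_add]
      have : (n : ℝ) < 2 ^ n := by exact_mod_cast Nat.lt_two_pow_self
      exact mul_lt_mul_of_pos_right this (by positivity)
    linarith
  · rw [objective_eq_sum hb, objective_eq_sum hb]
    simpa [weight, hb] using h

/-! ### Listing the Pareto front -/

section Front

variable {α : Type*} (G : α → ℝ) (I : α → ℕ)

/-- `φ` is undominated with respect to the objectives `G` and `I`. -/
def Efficient (φ : α) : Prop :=
  ∀ ψ, ¬ (G ψ ≤ G φ ∧ I ψ ≤ I φ ∧ (G ψ < G φ ∨ I ψ < I φ))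

/-- `L` lists the part of the Pareto front with `I < F`, and `g` is the smallest value of `G` on
all elements with `I < F`, if there are any. -/
structure FrontBelow (F : ℕ) (L : List α) (g : ℝ) : Prop where
  efficient : ∀ φ ∈ L, Efficient G I φ ∧ I φ < F
  complete : ∀ φ, Efficient G I φ → I φ < F → ∃ ψ ∈ L, G ψ = G φ ∧ I ψ = I φ
  pairwise : L.Pairwise fun φ ψ => ¬ (G φ = G ψ ∧ I φ = I ψ)
  of_nil : L = [] → ∀ φ, ¬ I φ < F
  le : L ≠ [] → ∀ φ, I φ < F → g ≤ G φ
  attained : L ≠ [] → ∃ φ, I φ < F ∧ G φ = g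

variable {G I}

theorem frontBelow_zero (g : ℝ) : FrontBelow G I 0 [] g :=
  ⟨by simp, by simp, by simp, by simp, by simp, by simp⟩

/-- A minimizer of `G` under the bound `I ≤ F` is listed if it improves on everything below. -/
theorem FrontBelow.append {F : ℕ} {L : List α} {g : ℝ} (h : FrontBelow G I F L g) {φ : α}
    (hφ : I φ ≤ F) (hmin : ∀ ψ, I ψ ≤ F → G φ ≤ G ψ) (hlt : L = [] ∨ G φ < g) :
    FrontBelow G I (F + 1) (L ++ [φ]) (G φ) := by
  have hbelow : ∀ ψ, I ψ < F → G φ < G ψ := by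
    intro ψ hψ
    by_cases hL : L = []
    · exact absurd hψ (h.of_nil hL ψ)
    · exact (hlt.resolve_left hL).trans_le (h.le hL ψ hψ)
  have hI : I φ = F := by
    by_contra hne
    exact lt_irrefl _ (hbelow φ (by omega))
  have heff : Efficient G I φ := by
    rintro ψ ⟨h1, h2, h3 | h3⟩
    · exact absurd (hmin ψ (by omega)) (not_le.2 h3)
    · exact absurd (hbelow ψ (by omega)) (not_lt.2 h1)
  refine ⟨fun ψ hψ => ?_, fun ψ hψ hψF => ?_, ?_, by simp, fun _ ψ hψ => hmin ψ (by omega),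
    fun _ => ⟨φ, by omega, rfl⟩⟩
  · rcases List.mem_append.1 hψ with hψ | hψ
    · exact ⟨(h.efficient ψ hψ).1, by have := (h.efficient ψ hψ).2; omega⟩
    · rw [List.mem_singleton.1 hψ]
      exact ⟨heff, by omega⟩
  · by_cases hψ' : I ψ < F
    · obtain ⟨χ, hχ, h1⟩ := h.complete ψ hψ hψ'
      exact ⟨χ, List.mem_append_left _ hχ, h1⟩
    · have hle := hmin ψ (by omega)
      refine ⟨φ, by simp, le_antisymm hle (le_of_not_gt fun hgt => ?_), by omega⟩
      exact hψ φ ⟨hle, by omega, Or.inl hgt⟩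
  · rw [List.pairwise_append]
    refine ⟨h.pairwise, List.pairwise_singleton _ _, fun ψ hψ χ hχ => ?_⟩
    rw [List.mem_singleton.1 hχ]
    rintro ⟨-, h2⟩
    have := (h.efficient ψ hψ).2
    omega

/-- Nothing with `I = F` is efficient if the minimizer `φ` of `G` under the bound `I ≤ F` does not
improve on what is below, or if no element obeys the bound. -/
theorem FrontBelow.skip {F : ℕ} {L : List α} {g : ℝ} (h : FrontBelow G I F L g) {φ : α}
    (hc : ∀ ψ, I ψ ≤ F → (∀ ψ, I ψ ≤ F → G φ ≤ G ψ) ∧ L ≠ [] ∧ g ≤ G φ) :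
    FrontBelow G I (F + 1) L g := by
  refine ⟨fun ψ hψ => ⟨(h.efficient ψ hψ).1, by have := (h.efficient ψ hψ).2; omega⟩,
    fun ψ hψ hψF => ?_, h.pairwise, fun hL ψ hψ => ?_, fun hL ψ hψ => ?_, fun hL => ?_⟩
  · by_cases hψ' : I ψ < F
    · exact h.complete ψ hψ hψ'
    · -- `ψ` is dominated by an element that attains the value `g`
      obtain ⟨hmin, hL, hg⟩ := hc ψ (by omega)
      obtain ⟨χ, hχ, hχg⟩ := h.attained hL
      have := hmin ψ (by omega)
      exact absurd ⟨by linarith, by omega, Or.inr (by omega)⟩ (hψ χ)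
  · exact (hc ψ (by omega)).2.1 hL
  · obtain ⟨hmin, -, hg⟩ := hc ψ (by omega)
    exact hg.trans (hmin ψ (by omega))
  · obtain ⟨χ, hχ, hχg⟩ := h.attained hL
    exact ⟨χ, by omega, hχg⟩

end Front

/-! ### The input -/

section Instance

variable {X : Type*} [MetricSpace X] {n k : ℕ} (p : ℝ≥0∞) (x : Fin n → X) (s : Fin k → X)
  (σ : Fin n → Fin 2)

/-- A clustering as a function on `ℕ`. -/
def extend (φ : Fin n → Fin k) (q : ℕ) : ℕ := if h : q < n then φ ⟨q, h⟩ else 0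

theorem extend_val (φ : Fin n → Fin k) (j : Fin n) : extend φ j = φ j := by
  simp [extend]

theorem extend_lt (φ : Fin n → Fin k) : ∀ q < n, extend φ q < k := by
  intro q hq
  simp [extend, hq]

/-- The attributes as a function on `ℕ`. -/
def attrOf (q : ℕ) : ℕ := if h : q < n then σ ⟨q, h⟩ else 0

theorem attrOf_lt : ∀ q < n, attrOf σ q < 2 := by
  intro q hq
  simp only [attrOf, hq, dif_pos]
  exact (σ _).isLt

/-- The contributions as a function on `ℕ`. -/
noncomputable def contrib (q v : ℕ) : ℝ :=
  if h : q < n ∧ v < k then contribution p x s ⟨q, h.1⟩ ⟨v, h.2⟩ else 0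

theorem contrib_nonneg (q v : ℕ) : 0 ≤ contrib p x s q v := by
  unfold contrib contribution
  split_ifs
  · exact dist_nonneg
  · exact Real.rpow_nonneg dist_nonneg _
  · exact le_rfl

theorem inputState_real : (inputState p x s σ).real 0 = contrib p x s := by
  funext q v
  simp [inputState, contrib]

theorem inputState_points : (inputState p x s σ).nat 0 0 0 = n := by simp [inputState]

theorem inputState_centers : (inputState p x s σ).nat 0 1 0 = k := by simp [inputState]

theorem inputState_bit : 1 ≤ (inputState p x s σ).nat 0 2 0 ↔ p = ∞ := by
  by_cases h : p = ∞ <;> simp [inputState, h]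

theorem inputState_attr : ∀ q < n, (inputState p x s σ).nat 1 q 0 = attrOf σ q := by
  intro q hq
  simp [inputState, attrOf, hq]

theorem inputState_length : (inputState p x s σ).nat 2 0 0 = 0 := by simp [inputState]

theorem contrib_extend (φ : Fin n → Fin k) (j : Fin n) :
    contrib p x s j (extend φ j) = contribution p x s j (φ j) := by
  simp [contrib, extend_val]

/-- The objective that the program compares determines the cost in a strictly monotone way. -/
theorem cost_le_cost_iff (hp : p ≠ 0) {b : ℕ} (hb : 1 ≤ b ↔ p = ∞) (φ ψ : Fin n → Fin k) :
    cost p x s φ ≤ cost p x s ψ ↔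
      objective b (contrib p x s) (extend φ) n ≤ objective b (contrib p x s) (extend ψ) n := by
  by_cases h : p = ∞
  · have key : ∀ χ : Fin n → Fin k,
        cost p x s χ = objective b (contrib p x s) (extend χ) n := by
      intro χ
      have hval : ∀ j : Fin n, contrib p x s j (extend χ j) = dist (x j) (s (χ j)) := fun j => by
        rw [contrib_extend, contribution, if_pos h]
      rw [cost, if_pos h]
      obtain ⟨h0, hle⟩ := (objective_le_iff (hb.2 h) (contrib p x s) (extend χ) n _).1 le_rfl
      refine le_antisymm (Real.iSup_le (fun j => (hval j).symm.le.trans (hle j j.isLt)) h0) ?_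
      refine (objective_le_iff (hb.2 h) _ _ _ _).2 ⟨Real.iSup_nonneg fun j => dist_nonneg,
        fun q hq => ?_⟩
      rw [hval ⟨q, hq⟩]
      exact le_ciSup (f := fun j => dist (x j) (s (χ j))) (Set.finite_range _).bddAbove ⟨q, hq⟩
    rw [key, key]
  · have key : ∀ χ : Fin n → Fin k, cost p x s χ =
        objective b (contrib p x s) (extend χ) n ^ (1 / p.toReal) := by
      intro χ
      rw [cost, if_neg h, objective_eq_sum (mt hb.1 h), Finset.sum_range]
      congr 1
      refine Finset.sum_congr rfl fun j _ => ?_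
      rw [contrib_extend, contribution, if_neg h]
    have hnn : ∀ χ : Fin n → Fin k, 0 ≤ objective b (contrib p x s) (extend χ) n := by
      intro χ
      rw [objective_eq_sum (mt hb.1 h)]
      exact Finset.sum_nonneg fun q _ => contrib_nonneg p x s _ _
    rw [key, key, Real.rpow_le_rpow_iff (hnn φ) (hnn ψ)
      (one_div_pos.2 (ENNReal.toReal_pos hp h))]

variable {σ} in
theorem bal_eq_groupCount (φ : Fin n → Fin k) (i : Fin k) :
    bal 0 (attrOf σ) (extend φ) n i = (groupCount σ φ i 0 : ℤ) - groupCount σ φ i 1 := by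
  simp only [bal, groupCount, Finset.card_filter, Nat.cast_sum, ← Finset.sum_sub_distrib]
  rw [Finset.sum_range]
  refine Finset.sum_congr rfl fun j _ => ?_
  have h1 : attrOf σ j = (σ j : ℕ) := by simp [attrOf]
  simp only [extend_val, sgn, h1, Fin.val_inj]
  rcases Fin.exists_fin_two.1 ⟨σ j, rfl⟩ with h | h <;> by_cases h2 : φ j = i <;> simp [h, h2]

theorem maxImbalance_le_iff (φ : Fin n → Fin k) (f : ℕ) :
    maxImbalance σ φ ≤ f ↔ ∀ v < k, |bal 0 (attrOf σ) (extend φ) n v| ≤ f := by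
  rw [maxImbalance, Finset.sup_le_iff]
  refine ⟨fun h v hv => ?_, fun h i _ => ?_⟩
  · have := h ⟨v, hv⟩ (Finset.mem_univ _)
    rw [bal_eq_groupCount φ ⟨v, hv⟩, Int.abs_eq_natAbs]
    exact_mod_cast this
  · have := h i i.isLt
    rw [bal_eq_groupCount φ i, Int.abs_eq_natAbs] at this
    exact_mod_cast this

theorem maxImbalance_le_card (φ : Fin n → Fin k) : maxImbalance σ φ ≤ n := by
  refine Finset.sup_le fun i _ => ?_
  have h : ∀ a, groupCount σ φ i a ≤ n := fun a =>
    (Finset.card_le_univ _).trans_eq (Fintype.card_fin n)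
  have h0 := h 0
  have h1 := h 1
  omega

theorem bal_congr {a : ℕ} {σ φ ψ : ℕ → ℕ} {j : ℕ} (h : ∀ q < j, φ q = ψ q) (v : ℕ) :
    bal a σ φ j v = bal a σ ψ j v :=
  Finset.sum_congr rfl fun q hq => by rw [h q (Finset.mem_range.1 hq)]

theorem listsParetoFront_of_frontBelow {p : ℝ≥0∞} {x : Fin n → X} {s : Fin k → X}
    {σ : Fin n → Fin 2} {G : (Fin n → Fin k) → ℝ}
    (hG : ∀ φ ψ, cost p x s φ ≤ cost p x s ψ ↔ G φ ≤ G ψ) {L : List (Fin n → Fin k)} {g : ℝ}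
    (h : FrontBelow G (maxImbalance σ) (n + 1) L g) : ListsParetoFront p x s σ L := by
  have hlt : ∀ φ ψ, cost p x s φ < cost p x s ψ ↔ G φ < G ψ := fun φ ψ => by
    rw [← not_le, ← not_le, hG]
  have heq : ∀ φ ψ, cost p x s φ = cost p x s ψ ↔ G φ = G ψ := fun φ ψ => by
    rw [le_antisymm_iff, le_antisymm_iff, hG, hG]
  have heff : ∀ φ, Undominated p x s σ φ ↔ Efficient G (maxImbalance σ) φ := fun φ => by
    simp only [Undominated, Dominates, Efficient, hG, hlt]
  refine ⟨fun φ hφ => (heff φ).2 (h.efficient φ hφ).1, fun φ hφ => ?_, ?_⟩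
  · obtain ⟨ψ, hψ, h1⟩ := h.complete φ ((heff φ).1 hφ)
      (Nat.lt_succ_of_le (maxImbalance_le_card σ φ))
    exact ⟨ψ, hψ, (heq _ _).2 h1.1, h1.2⟩
  · simpa only [heq] using h.pairwise

end Instance

/-- Appending a clustering to the list in the memory. -/
theorem Outputs.append {n k : ℕ} {m m' : State} {L : List (Fin n → Fin k)} (h : Outputs m L)
    (φ : Fin n → Fin k) (hl : m'.nat 2 0 0 = L.length + 1)
    (hrow : ∀ j : Fin n, m'.nat 3 L.length j = φ j)
    (hold : ∀ r, r ≠ L.length → m'.nat 3 r = m.nat 3 r) : Outputs m' (L ++ [φ]) := by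
  refine ⟨by simpa using hl, fun r j => ?_⟩
  have hr : (r : ℕ) < L.length + 1 := by simpa using r.isLt
  rw [List.get_eq_getElem]
  rcases Nat.lt_succ_iff_lt_or_eq.1 hr with h1 | h1
  · rw [List.getElem_append_left h1, hold r h1.ne]
    exact h.2 ⟨r, h1⟩ j
  · rw [List.getElem_append_right h1.ge]
    simpa [h1] using hrow j

/-! ### Correctness of the program -/

section Correctness

variable {X : Type*} [MetricSpace X] {n k : ℕ}

theorem wp_paretoProgram (x : Fin n → X) (s : Fin k → X) (σ : Fin n → Fin 2) (p : ℝ≥0∞)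
    (hp : p ≠ 0) :
    Wp (n + k) paretoProgram
      (fun m' => ∃ L : List (Fin n → Fin k), Outputs m' L ∧ ListsParetoFront p x s σ L)
      (inputState p x s σ) := by
  set m := inputState p x s σ with hm
  have hn : m.nat 0 0 0 = n := inputState_points p x s σ
  have hk : m.nat 0 1 0 = k := inputState_centers p x s σ
  refine wp_ite (fun hb => wp_skip ?_) fun hb => wp_seq ?_
  · -- there are no clusterings at all
    simp only [BExp.holds, NExp.eval, hn, hk] at hb
    obtain ⟨hk0, hn0⟩ := hb
    have : IsEmpty (Fin n → Fin k) :=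
      ⟨fun φ => absurd (φ ⟨0, hn0⟩).isLt (by omega)⟩
    exact ⟨[], ⟨inputState_length p x s σ, fun r => r.elim0⟩, by simp,
      fun φ => isEmptyElim φ, List.Pairwise.nil⟩
  simp only [BExp.holds, NExp.eval, hn, hk] at hb
  have hk0 : 0 < k ∨ n = 0 := by omega
  set d := contrib p x s with hd
  have hd0 : ∀ q v, 0 ≤ d q v := contrib_nonneg p x s
  set b := m.nat 0 2 0 with hbit
  set G : (Fin n → Fin k) → ℝ := fun φ => objective b d (extend φ) n with hG
  have hcost := cost_le_cost_iff p x s hp (inputState_bit p x s σ)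
  refine (wp_weights hn hk le_rfl).mono ?_
  rintro m1 hF1 ⟨hW, hM⟩
  rw [inputState_real, ← hd, ← hbit] at hW hM
  have hM0 : 0 ≤ m1.real 2 0 0 := by
    rw [hM]
    exact add_nonneg zero_le_one (Finset.sum_nonneg fun q _ => Finset.sum_nonneg fun v _ =>
      weight_nonneg hd0 q v)
  have hWM : ∑ q ∈ Finset.range n, ∑ v ∈ Finset.range k, m1.real 1 q v < m1.real 2 0 0 := by
    rw [hM, Finset.sum_congr rfl fun q hq => Finset.sum_congr rfl fun v hv =>
      hW q (Finset.mem_range.1 hq) v (Finset.mem_range.1 hv)]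
    exact lt_one_add _
  refine wp_forLoop (B := n + 1) (fun F m' => ∃ L : List (Fin n → Fin k), Outputs m' L ∧
    FrontBelow G (maxImbalance σ) F L (m'.real 7 0 0)) (by omega) rfl ?_ ?_ ?_ ?_
  · intro m' hF
    simp [NExp.eval, hF.1 0 rfl, hF1.1 0 rfl, hn]
  · refine ⟨[], ⟨?_, fun r => r.elim0⟩, frontBelow_zero _⟩
    rw [State.putNat_nat_ne _ _ _ _ (by decide), hF1.1 2 rfl]
    exact inputState_length p x s σ
  · rintro F m2 _ hF2 hv2 ⟨L, hL, hfront⟩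
    refine (wp_round (n := n) (k := k) (σ := attrOf σ) (W := m1.real 1) (f := F)
      (M := m1.real 2 0 0) (l := L.length) (by rw [hF2.1 0 rfl, hF1.1 0 rfl, hn])
      (by rw [hF2.1 0 rfl, hF1.1 0 rfl, hk]) hk0
      (fun q hq => by rw [hF2.1 1 rfl, hF1.1 1 rfl]; exact inputState_attr p x s σ q hq)
      (attrOf_lt σ) (by rw [hF2.2 1 rfl]) hv2 (by rw [hF2.2 2 rfl]) hM0 hL.1 le_rfl).mono ?_
    rintro m3 _ ⟨φ, ρ, hC, hcase⟩
    rw [hF2.1 0 rfl, hF1.1 0 rfl, ← hbit, hF2.2 0 rfl, hF1.2 0 rfl, inputState_real, ← hd] at hcase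
    have hφ : ∀ q < n, φ q < k := fun q hq => (hC.cheapest q hq).1
    -- the assignment found by the program, as a clustering
    set Φ : Fin n → Fin k := fun j => ⟨φ j, hφ j j.isLt⟩ with hΦ
    have hext : ∀ q < n, φ q = extend Φ q := fun q hq => by simp [extend, hq, hΦ]
    have hGφ : objective b d φ n = G Φ := objective_congr hext
    have hbal : (∀ v < k, |bal 0 (attrOf σ) φ n v| ≤ F) ↔ maxImbalance σ Φ ≤ F := by
      rw [maxImbalance_le_iff]
      simp only [bal_congr hext]
    have hmin : ∀ ψ, maxImbalance σ ψ ≤ F → G Φ ≤ G ψ := by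
      intro ψ hψ
      rw [← hGφ]
      refine objective_mono hd0 (extend_lt ψ) ?_
      have := hC.sum_le hM0 (extend_lt ψ) ((maxImbalance_le_iff σ ψ F).1 hψ)
      rwa [Finset.sum_congr rfl fun q hq => hW q (Finset.mem_range.1 hq) _
          (hφ q (Finset.mem_range.1 hq)),
        Finset.sum_congr rfl fun q hq => hW q (Finset.mem_range.1 hq) _
          (extend_lt ψ q (Finset.mem_range.1 hq))] at this
    have hfeas : ∀ ψ, maxImbalance σ ψ ≤ F → maxImbalance σ Φ ≤ F := fun ψ hψ =>
      hbal.1 (hC.balanced (fun q hq v hv => by rw [hW q hq v hv]; exact weight_nonneg hd0 q v) hWM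
        (extend_lt ψ) ((maxImbalance_le_iff σ ψ F).1 hψ))
    simp only [hbal, hGφ, List.length_eq_zero_iff] at hcase
    have e7 : (m3.putNat 5 0 0 (F + 1)).real 7 = m3.real 7 := rfl
    rcases hcase with ⟨h1, h2, h3, h4, h5, h6⟩ | ⟨h1, h2, h3, h4⟩
    · refine ⟨L ++ [Φ], hL.append Φ ?_ ?_ ?_, ?_⟩
      · rwa [State.putNat_nat_ne _ _ _ _ (by decide)]
      · intro j
        rw [State.putNat_nat_ne _ _ _ _ (by decide)]
        exact h5 j j.isLt
      · rwa [State.putNat_nat_ne _ _ _ _ (by decide)]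
      · rw [e7, h4]
        exact hfront.append h1 hmin h2
    · refine ⟨L, ⟨?_, ?_⟩, ?_⟩
      · rw [State.putNat_nat_ne _ _ _ _ (by decide), h2]
      · rw [State.putNat_nat_ne _ _ _ _ (by decide), h4]
        exact hL.2
      · rw [e7, h3]
        refine hfront.skip (φ := Φ) fun ψ hψ => ⟨hmin, fun hnil => h1 ⟨hfeas ψ hψ, Or.inl hnil⟩, ?_⟩
        by_contra hc
        exact h1 ⟨hfeas ψ hψ, Or.inr (not_le.1 hc)⟩
  · rintro m' _ ⟨L, hL, hfront⟩
    exact ⟨L, hL, listsParetoFront_of_frontBelow hcost hfront⟩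

end Correctness

end FairAssign

theorem theoremB1 :
    ∃ (prog : FairAssign.Cmd) (P : Polynomial ℕ),
      ∀ (X : Type*) [MetricSpace X] (n k : ℕ) (x : Fin n → X) (s : Fin k → X)
        (σ : Fin n → Fin 2) (p : ENNReal), p ≠ 0 →
        ∃ (t : ℕ) (m : FairAssign.State) (L : List (Fin n → Fin k)),
          FairAssign.Exec prog (FairAssign.inputState p x s σ) t m ∧
          t ≤ P.eval (n + k) ∧
          FairAssign.Outputs m L ∧
          FairAssign.ListsParetoFront p x s σ L := by
  refine ⟨FairAssign.paretoProgram, FairAssign.paretoProgram.bound, ?_⟩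
  intro X _ n k x s σ p hp
  obtain ⟨t, m, h, ht, L, hL, hfront⟩ := FairAssign.wp_paretoProgram x s σ p hp
  exact ⟨t, m, L, h, ht, hL, hfront⟩
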